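/- For every $k\in\mathbb N$ there is a constant $c_k>0$, depending only on $k$, such that the following holds. Let $\mathcal C$ be a random quantum circuit on $n$ qubits with a fixed architecture, that is, a fixed finite sequence of gate positions, each gate acting on $k$ distinct qubits, where the gates are independent Haar random unitaries in $U(2^k)$. The gates acting on a wire cut that wire into segments, which are called the qubits in space-time. A path of length $L$ between two space-time qubits $r$ and $r'$ is a sequence $r=r_0,r_1,\dots,r_L=r'$ of space-time qubits such that for each $i<L$ some gate of the circuit has $r_i$ as an input and $r_{i+1}$ as an output. Say that $r$ and $r'$ are depth $D$ apart if there is a path of length $D$ between them and every path between them has length at least $D$. Let an input qubit (on wire $a$) and an output qubit (on wire $b$) be depth $D$ apart. Fix an arbitrary joint state (density matrix) $\tau$ of the $n-1$ input qubits other than $a$, and let $\Phi_{\mathcal C}$ be the channel that maps a state $\rho$ of the input qubit to the state of the output qubit, i.e. $\Phi_{\mathcal C}(\rho)=\mathrm{Tr}_{\{1,\dots,n\}\setminus\{b\}}\big[U_{\mathcal C}(\rho\otimes\tau)U_{\mathcal C}^\dagger\big]$, where $U_{\mathcal C}$ is the unitary implemented by $\mathcal C$. Then for every $\gamma>0$,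 with probability at least $1-\gamma$ over $\mathcal C$ the following holds: for every two single-qubit states (density matrices) $\rho$ and $\rho'$, $$\|\Phi_{\mathcal C}(\rho)-\Phi_{\mathcal C}(\rho')\|_F\ \ge\ \|\rho-\rho'\|_F\cdot(2^{-D}\gamma)^{c_k},$$ where $\|\cdot\|_F$ is the Frobenius norm. -/

import Mathlib

noncomputable section

namespace RandomCircuit

open MeasureTheory
open scoped Kronecker Matrix ComplexOrder

/-! ### States and norms -/

/-- Operators on the Hilbert space `(ℂ²)^{⊗ ι}` of a system of qubits labelled by `ι`,
as matrices in the computational basis (the basis vectors are the bit strings `ι → Fin 2`). -/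
abbrev QMatrix (ι : Type) : Type := Matrix (ι → Fin 2) (ι → Fin 2) ℂ

/-- Density matrices: positive semidefinite (in particular Hermitian) matrices of trace one. -/
def IsDensity {d : Type} [Fintype d] (ρ : Matrix d d ℂ) : Prop :=
  ρ.PosSemidef ∧ ρ.trace = 1

/-- The Frobenius norm `(∑ i j, |A i j|²)^{1/2}`. -/
def frobNorm {d : Type} [Fintype d] (A : Matrix d d ℂ) : ℝ :=
  Matrix.frobeniusNormedAddCommGroup.toNorm.norm A

/-! ### The Haar measure on the unitary group -/

/-- Unitary gates on `k` qubits: the group `U(2^k)`. -/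
abbrev Gate (k : ℕ) : Type := Matrix.unitaryGroup (Fin k → Fin 2) ℂ

instance instMeasurableSpaceGate (k : ℕ) : MeasurableSpace (Gate k) := borel (Gate k)

instance instBorelSpaceGate (k : ℕ) : BorelSpace (Gate k) := ⟨rfl⟩

instance instCompactSpaceGate (k : ℕ) : CompactSpace (Gate k) := by
  refine isCompact_iff_compactSpace.mp ?_
  have hK : IsCompact (Set.univ.pi fun _ : Fin k → Fin 2 =>
      Set.univ.pi fun _ : Fin k → Fin 2 => Metric.closedBall (0 : ℂ) 1) :=
    isCompact_univ_pi fun _ => isCompact_univ_pi fun _ => isCompact_closedBall _ _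
  refine IsCompact.of_isClosed_subset hK ?_ ?_
  · have h : ((Matrix.unitaryGroup (Fin k → Fin 2) ℂ : Set (QMatrix (Fin k)))) =
        {A | star A * A = 1} ∩ {A | A * star A = 1} := by
      ext A
      exact Unitary.mem_iff
    have hs : Continuous fun A : QMatrix (Fin k) => star A :=
      continuous_id.matrix_conjTranspose
    change IsClosed ((Matrix.unitaryGroup (Fin k → Fin 2) ℂ : Set (QMatrix (Fin k))))
    rw [h]
    exact (isClosed_eq (hs.matrix_mul continuous_id) continuous_const).inter
      (isClosed_eq (continuous_id.matrix_mul hs) continuous_const)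
  · intro A hA i _ j _
    simpa using entry_norm_bound_of_unitary hA i j

/-- The Haar probability measure on `U(2^k)`. -/
def haarGate (k : ℕ) : Measure (Gate k) := Measure.haarMeasure ⊤

instance instIsProbabilityMeasureHaarGate (k : ℕ) : IsProbabilityMeasure (haarGate k) :=
  ⟨by simpa [haarGate] using Measure.haarMeasure_self (K₀ := (⊤ : TopologicalSpace.PositiveCompacts (Gate k)))⟩

/-! ### Circuits -/

/-- A circuit architecture on `n` qubits with `k`-qubit gates: the gates are listed in an order in
which they are applied, and `pos g` is the tuple of distinct qubits on which gate `g` acts. -/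
structure Architecture (n k : ℕ) where
  numGates : ℕ
  pos : Fin numGates → (Fin k ↪ Fin n)

variable {n k : ℕ}

/-- The `k`-qubit gate `G` applied to the qubits `pos 0, …, pos (k - 1)` of an `n`-qubit system,
tensored with the identity on all other qubits. -/
def gateOp (pos : Fin k ↪ Fin n) (G : Gate k) : QMatrix (Fin n) :=
  Matrix.of fun x y =>
    if ∀ q, (∀ i, pos i ≠ q) → x q = y q then (G : QMatrix (Fin k)) (x ∘ pos) (y ∘ pos) else 0

/-- A choice of the gates of a circuit with architecture `A`. -/
abbrev Circuit (A : Architecture n k) : Type := Fin A.numGates → Gate k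

/-- The law of a random circuit: the gates are independent and Haar distributed. -/
def randomCircuit (A : Architecture n k) : Measure (Circuit A) :=
  Measure.pi fun _ => haarGate k

/-- The unitary implemented by the circuit: gate `0` is applied first, so it is the rightmost
factor of the product. -/
def circuitOp (A : Architecture n k) (C : Circuit A) : QMatrix (Fin n) :=
  (List.ofFn fun g => gateOp (A.pos g) (C g)).reverse.prod

/-- The joint state `ρ ⊗ τ`, with `ρ` on qubit `a` and `τ` on all qubits other than `a`. -/
def insertQubit (a : Fin n) (ρ : Matrix (Fin 2) (Fin 2) ℂ) (τ : QMatrix {q : Fin n // q ≠ a}) :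
    QMatrix (Fin n) :=
  (ρ ⊗ₖ τ).submatrix (Equiv.funSplitAt a (Fin 2)) (Equiv.funSplitAt a (Fin 2))

/-- The reduced state of qubit `b`: the partial trace over all qubits other than `b`. -/
def reduceTo (b : Fin n) (σ : QMatrix (Fin n)) : Matrix (Fin 2) (Fin 2) ℂ :=
  Matrix.of fun s t => ∑ z : {q : Fin n // q ≠ b} → Fin 2,
    σ ((Equiv.funSplitAt b (Fin 2)).symm (s, z)) ((Equiv.funSplitAt b (Fin 2)).symm (t, z))

/-- The channel that maps the state `ρ` of the input qubit `a` to the state of the output qubit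
`b`, when the other input qubits are in the joint state `τ`. -/
def channel (A : Architecture n k) (C : Circuit A) (a b : Fin n) (τ : QMatrix {q : Fin n // q ≠ a})
    (ρ : Matrix (Fin 2) (Fin 2) ℂ) : Matrix (Fin 2) (Fin 2) ℂ :=
  reduceTo b (circuitOp A C * insertQubit a ρ τ * (circuitOp A C)ᴴ)

/-! ### Paths in space-time -/

/-- Gate `g` acts on the wire `q`. -/
def Architecture.ActsOn (A : Architecture n k) (g : Fin A.numGates) (q : Fin n) : Prop :=
  ∃ i, A.pos g i = q

/-- A qubit in space-time. The gates acting on a wire cut it into segments, and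
`⟨q, s⟩` is the segment of wire `q` after `s` gates have acted on that wire. -/
structure SpaceTimeQubit (n : ℕ) where
  wire : Fin n
  segment : ℕ

/-- The number of gates before gate `g` that act on wire `q`. -/
def Architecture.numBefore (A : Architecture n k) (g : Fin A.numGates) (q : Fin n) : ℕ :=
  Set.ncard {h : Fin A.numGates | h < g ∧ A.ActsOn h q}

/-- The input qubit on wire `q`. -/
def inputQubit (q : Fin n) : SpaceTimeQubit n := ⟨q, 0⟩

/-- The output qubit on wire `q`. -/
def Architecture.outputQubit (A : Architecture n k) (q : Fin n) : SpaceTimeQubit n :=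
  ⟨q, Set.ncard {h : Fin A.numGates | A.ActsOn h q}⟩

/-- The space-time qubit `r` is an input of gate `g`. -/
def Architecture.IsGateInput (A : Architecture n k) (g : Fin A.numGates)
    (r : SpaceTimeQubit n) : Prop :=
  A.ActsOn g r.wire ∧ r.segment = A.numBefore g r.wire

/-- The space-time qubit `r` is an output of gate `g`. -/
def Architecture.IsGateOutput (A : Architecture n k) (g : Fin A.numGates)
    (r : SpaceTimeQubit n) : Prop :=
  A.ActsOn g r.wire ∧ r.segment = A.numBefore g r.wire + 1

/-- There is a path `r = p 0, p 1, …, p L = r'` of length `L` in space-time: for each `i < L` some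
gate has `p i` as an input and `p (i + 1)` as an output. -/
def Architecture.HasPath (A : Architecture n k) (r r' : SpaceTimeQubit n) (L : ℕ) : Prop :=
  ∃ p : ℕ → SpaceTimeQubit n, p 0 = r ∧ p L = r' ∧
    ∀ i < L, ∃ g, A.IsGateInput g (p i) ∧ A.IsGateOutput g (p (i + 1))

/-- `r` and `r'` are depth `D` apart: there is a path of length `D` from `r` to `r'`, and every path
from `r` to `r'` has length at least `D`. -/
def Architecture.DepthApart (A : Architecture n k) (r r' : SpaceTimeQubit n) (D : ℕ) : Prop :=
  A.HasPath r r' D ∧ ∀ L, A.HasPath r r' L → D ≤ L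

end RandomCircuit

end

noncomputable section

namespace RandomCircuit

open MeasureTheory
open scoped Kronecker Matrix ComplexOrder

variable {n k : ℕ}

/-! ### Negative moments of polynomials on the unit circle -/

/-! Once the other inputs are fixed, the map from the input qubit to any one wire is linear, and its
matrix in the basis of matrix units is the 4×4 `transferMatrix`. Its entries are bounded, so its
adjugate is too, and by Cramer's rule a lower bound on `|det|` limits the contraction of all
differences of states at once (`det_mul_frobNorm_le`). It remains to show that `|det|` is rarely
small, which follows by Markov's inequality from `E |det|^(-1/16) ≤ K ^ D` with `K` depending only
on `k` (`lintegral_det_le`).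

This moment is followed along a path of length `D`. A gate that misses the current wire leaves the
reduced state there unchanged and costs nothing. A gate that carries the path from one of its wires
to another costs a factor `K`: if it were the swap of these wires, the determinant would be exactly
the one before the gate, and a negative moment over the random gate is controlled by the value at
any single gate (`lintegral_det_gate_le`).

The last principle is an anti-concentration statement for polynomials on the unitary group. On a
circle, a polynomial of degree at most 8 has negative moments controlled by its value at any point
(`lintegral_circle_polynomial_le`). The unitary group is a finite product of circles `1 + (z - 1)
Q`, because columns can be cleared by phases and rotations as in Gaussian elimination. Integrating
over one circle after another gives the bound for some probability measure on the whole group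
(`controlsMoments_univ`). Haar invariance transfers it to the random circuit: multiplying one gate
by an independent sample of that measure does not change the law (`lintegral_randomCircuit_le`). -/

instance : IsProbabilityMeasure (volume : Measure UnitAddCircle) :=
  ⟨UnitAddCircle.measure_univ⟩

theorem ennreal_rpow_neg_le {x y : ENNReal} (h : x ≤ y) {s : ℝ} (hs : 0 ≤ s) :
    y ^ (-s) ≤ x ^ (-s) := by
  rw [ENNReal.rpow_neg, ENNReal.rpow_neg, ENNReal.inv_le_inv]
  exact ENNReal.rpow_le_rpow h hs

theorem continuous_coe_toCircle :
    Continuous fun x : UnitAddCircle => ((AddCircle.toCircle x : Circle) : ℂ) :=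
  continuous_subtype_val.comp AddCircle.continuous_toCircle

theorem norm_toCircle_sub_one (x : ℝ) (hx : |x| ≤ 1 / 2) :
    |x| ≤ ‖((AddCircle.toCircle (x : UnitAddCircle) : Circle) : ℂ) - 1‖ := by
  rw [AddCircle.toCircle_apply_mk, Circle.coe_exp, mul_comm _ Complex.I,
    Complex.norm_exp_I_mul_ofReal_sub_one]
  have h1 : |2 * Real.pi / 1 * x / 2| ≤ Real.pi / 2 := by
    rw [show 2 * Real.pi / 1 * x / 2 = Real.pi * x by ring, abs_mul, abs_of_pos Real.pi_pos]
    nlinarith [Real.pi_pos]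
  have h2 := Real.mul_abs_le_abs_sin h1
  rw [show |2 * Real.pi / 1 * x / 2| = Real.pi * |x| by
    rw [show 2 * Real.pi / 1 * x / 2 = Real.pi * x by ring, abs_mul, abs_of_pos Real.pi_pos],
    show 2 / Real.pi * (Real.pi * |x|) = 2 * |x| by field_simp] at h2
  rw [Real.norm_eq_abs, abs_mul, abs_two]
  linarith [abs_nonneg x]

theorem lintegral_abs_rpow_lt_top :
    ∫⁻ x : ℝ in Set.Ioc (-(1 / 2)) (-(1 / 2) + 1), ‖x‖ₑ ^ (-(1 / 2) : ℝ) < ⊤ := by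
  have key : ∀ x : ℝ, x ≠ 0 → ‖x‖ₑ ^ (-(1 / 2) : ℝ) = ‖|x| ^ (-(1 / 2) : ℝ)‖ₑ := by
    intro x hx
    rw [Real.enorm_eq_ofReal_abs x,
      Real.enorm_eq_ofReal (by positivity), ENNReal.ofReal_rpow_of_pos (abs_pos.mpr hx)]
  have hi : IntervalIntegrable (fun x : ℝ => |x| ^ (-(1 / 2) : ℝ)) volume (-(1 / 2)) (1 / 2) := by
    have h0 : IntervalIntegrable (fun x : ℝ => |x| ^ (-(1 / 2) : ℝ)) volume 0 (1 / 2) := by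
      refine (intervalIntegral.intervalIntegrable_rpow' (r := -(1 / 2))
        (by norm_num)).congr ?_
      intro x hx
      rw [Set.uIoc_of_le (by norm_num)] at hx
      simp only [abs_of_pos hx.1]
    have h1 := h0.comp_sub_left 0
    simp only [zero_sub, sub_zero, abs_neg] at h1
    exact h1.symm.trans h0
  have h2 := ((intervalIntegrable_iff_integrableOn_Ioc_of_le (by norm_num)).mp hi).2
  rw [hasFiniteIntegral_iff_enorm] at h2
  rw [show (-(1 / 2) + 1 : ℝ) = 1 / 2 by norm_num]
  refine lt_of_eq_of_lt (lintegral_congr_ae ?_) h2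
  have h3 : ∀ᵐ x : ℝ, x ≠ 0 := by
    simp [ae_iff, measure_singleton]
  filter_upwards [ae_restrict_of_ae h3] with x hx using key x hx

/-- The mean of `|z - 1|^{-1/2}` over the unit circle. -/
def circleConst : ENNReal :=
  ∫⁻ x : UnitAddCircle, ‖((AddCircle.toCircle x : Circle) : ℂ) - 1‖ₑ ^ (-(1 / 2) : ℝ)

theorem measurable_circle_sub_rpow (ζ : ℂ) (s : ℝ) :
    Measurable fun x : UnitAddCircle => ‖((AddCircle.toCircle x : Circle) : ℂ) - ζ‖ₑ ^ s :=
  (continuous_coe_toCircle.sub continuous_const).measurable.enorm.pow_const s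

theorem circleConst_ne_top : circleConst ≠ ⊤ := by
  refine ne_of_lt (lt_of_le_of_lt ?_ lintegral_abs_rpow_lt_top)
  rw [circleConst, ← UnitAddCircle.lintegral_preimage (-(1 / 2))]
  refine setLIntegral_mono' measurableSet_Ioc fun x hx => ?_
  refine ennreal_rpow_neg_le ?_ (by norm_num)
  rw [Real.enorm_eq_ofReal_abs x, ← ofReal_norm]
  refine ENNReal.ofReal_le_ofReal (norm_toCircle_sub_one x (abs_le.mpr ⟨hx.1.le, ?_⟩))
  linarith [hx.2]

theorem exists_toCircle_eq (ζ : Circle) : ∃ y : UnitAddCircle, AddCircle.toCircle y = ζ := by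
  obtain ⟨t, rfl⟩ := Circle.exp_surjective ζ
  refine ⟨((t / (2 * Real.pi) : ℝ) : UnitAddCircle), ?_⟩
  rw [AddCircle.toCircle_apply_mk]
  congr 1
  field_simp

theorem lintegral_circle_sub (ζ : Circle) :
    ∫⁻ x : UnitAddCircle, ‖((AddCircle.toCircle x : Circle) : ℂ) - ζ‖ₑ ^ (-(1 / 2) : ℝ) =
      circleConst := by
  obtain ⟨y, rfl⟩ := exists_toCircle_eq ζ
  rw [circleConst, ← lintegral_add_right_eq_self _ y]
  refine lintegral_congr fun x => ?_
  rw [AddCircle.toCircle_add, Circle.coe_mul, ← sub_one_mul, enorm_mul,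
    show ‖((AddCircle.toCircle y : Circle) : ℂ)‖ₑ = 1 by
    rw [← ofReal_norm, Circle.norm_coe, ENNReal.ofReal_one], mul_one]

/-- Take `ζ` to be the radial projection of `w`, a nearest point of the circle: then `|z - ζ| ≤ 2 |z
- w|`. Combine this with `|z₀ - w| ≤ 2 + |z - w|` and `|z - ζ| ≤ 2`. Moving roots onto the circle
makes the later integral independent of where they were. -/
theorem exists_circle_root_bound (w : ℂ) :
    ∃ ζ : Circle, ∀ z₀ z : Circle, ‖(z₀ : ℂ) - w‖ * ‖(z : ℂ) - ζ‖ ≤ 6 * ‖(z : ℂ) - w‖ := by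
  obtain ⟨ζ, hζ⟩ : ∃ ζ : Circle, w = ‖w‖ * ζ :=
    ⟨Circle.exp w.arg, by rw [Circle.coe_exp, Complex.norm_mul_exp_arg_mul_I]⟩
  refine ⟨ζ, fun z₀ z => ?_⟩
  have h1 : ‖(z : ℂ) - ζ‖ ≤ 2 * ‖(z : ℂ) - w‖ := by
    have h2 : ‖w - ζ‖ ≤ ‖(z : ℂ) - w‖ := by
      have h3 : w - ζ = ((‖w‖ - 1 : ℝ) : ℂ) * ζ := by
        conv_lhs => rw [hζ]
        push_cast
        ring
      rw [h3, norm_mul, Circle.norm_coe, mul_one, Complex.norm_real, Real.norm_eq_abs]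
      have := abs_norm_sub_norm_le w (z : ℂ)
      rwa [Circle.norm_coe, norm_sub_rev] at this
    calc ‖(z : ℂ) - ζ‖ = ‖((z : ℂ) - w) + (w - ζ)‖ := by congr 1; ring
      _ ≤ _ := norm_add_le _ _
      _ ≤ _ := by linarith
  have h4 : ∀ x y : Circle, ‖(x : ℂ) - y‖ ≤ 2 := fun x y => by
    have := norm_sub_le (x : ℂ) y
    rw [Circle.norm_coe, Circle.norm_coe] at this
    linarith
  have h5 : ‖(z₀ : ℂ) - w‖ ≤ 2 + ‖(z : ℂ) - w‖ := by
    calc ‖(z₀ : ℂ) - w‖ = ‖((z₀ : ℂ) - z) + (z - w)‖ := by congr 1; ring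
      _ ≤ _ := norm_add_le _ _
      _ ≤ _ := by linarith [h4 z₀ z]
  nlinarith [h4 z ζ, norm_nonneg ((z : ℂ) - w), norm_nonneg ((z : ℂ) - ζ)]

theorem exists_circle_roots (d : ℕ) : ∀ q : Polynomial ℂ, q.natDegree ≤ d →
    ∃ ζ : Fin d → Circle, ∀ z₀ z : Circle,
      ‖q.eval (z₀ : ℂ)‖ * ∏ i, ‖(z : ℂ) - ζ i‖ ≤ 6 ^ d * ‖q.eval (z : ℂ)‖ := by
  induction d with
  | zero =>
    intro q hq
    rw [Polynomial.eq_C_of_natDegree_le_zero hq]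
    exact ⟨fun _ => 1, by simp⟩
  | succ d ih =>
    intro q hq
    by_cases h0 : q.natDegree = 0
    · rw [Polynomial.eq_C_of_natDegree_eq_zero h0]
      -- Missing roots are padded by the point `1`, harmless since `|z - 1| ≤ 2 ≤ 6`.
      refine ⟨fun _ => 1, fun z₀ z => ?_⟩
      rw [Polynomial.eval_C, Polynomial.eval_C, mul_comm]
      refine mul_le_mul_of_nonneg_right ?_ (norm_nonneg _)
      calc ∏ i : Fin (d + 1), ‖(z : ℂ) - (1 : Circle)‖ ≤ ∏ i : Fin (d + 1), (6 : ℝ) := by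
            refine Finset.prod_le_prod (fun _ _ => norm_nonneg _) fun _ _ => ?_
            have := norm_sub_le (z : ℂ) (1 : Circle)
            rw [Circle.norm_coe, Circle.norm_coe] at this
            linarith
        _ = _ := by simp
    · obtain ⟨w, hw⟩ := IsAlgClosed.exists_root q
        (fun h => h0 (Polynomial.natDegree_eq_of_degree_eq_some h))
      obtain ⟨r, rfl⟩ := Polynomial.dvd_iff_isRoot.mpr hw
      have hr : r ≠ 0 := by
        rintro rfl
        simp at h0
      rw [Polynomial.natDegree_mul (Polynomial.X_sub_C_ne_zero w) hr,
        Polynomial.natDegree_X_sub_C] at hq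
      obtain ⟨ζ, hζ⟩ := ih r (by omega)
      obtain ⟨η, hη⟩ := exists_circle_root_bound w
      refine ⟨Fin.cons η ζ, fun z₀ z => ?_⟩
      rw [Fin.prod_univ_succ]
      simp only [Fin.cons_zero, Fin.cons_succ, Polynomial.eval_mul, Polynomial.eval_sub,
        Polynomial.eval_X, Polynomial.eval_C, norm_mul]
      calc ‖(z₀ : ℂ) - w‖ * ‖r.eval (z₀ : ℂ)‖ * (‖(z : ℂ) - η‖ * ∏ i, ‖(z : ℂ) - ζ i‖)
          = (‖(z₀ : ℂ) - w‖ * ‖(z : ℂ) - η‖) *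
              (‖r.eval (z₀ : ℂ)‖ * ∏ i, ‖(z : ℂ) - ζ i‖) := by ring
        _ ≤ (6 * ‖(z : ℂ) - w‖) * (6 ^ d * ‖r.eval (z : ℂ)‖) :=
            mul_le_mul (hη z₀ z) (hζ z₀ z)
              (mul_nonneg (norm_nonneg _) (Finset.prod_nonneg fun _ _ => norm_nonneg _))
              (by positivity)
        _ = _ := by ring

/-- Negative moments of a polynomial of degree at most `8` on the unit circle are controlled by
the value at an arbitrary point of the circle. -/
theorem lintegral_circle_polynomial_le (q : Polynomial ℂ) (hq : q.natDegree ≤ 8) (z₀ : Circle) :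
    ∫⁻ x : UnitAddCircle,
        ‖q.eval ((AddCircle.toCircle x : Circle) : ℂ)‖ₑ ^ (-(1 / 16) : ℝ) ≤
      (6 * circleConst) * ‖q.eval (z₀ : ℂ)‖ₑ ^ (-(1 / 16) : ℝ) := by
  obtain ⟨ζ, hζ⟩ := exists_circle_roots 8 q hq
  by_cases h0 : q.eval (z₀ : ℂ) = 0
  -- At a zero of `q` the right side must be `⊤`, which needs a nonzero constant because `0 * ⊤ =
  -- 0`.
  · have hc : circleConst ≠ 0 := by
      rw [circleConst, Ne, lintegral_eq_zero_iff (measurable_circle_sub_rpow 1 _)]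
      intro h
      obtain ⟨z, hz⟩ := h.exists
      simp only [Pi.zero_apply, ENNReal.rpow_eq_zero_iff, enorm_ne_top, false_and, or_false] at hz
      exact absurd hz.2 (by norm_num)
    rw [h0, enorm_zero, ENNReal.zero_rpow_of_neg (by norm_num),
      ENNReal.mul_top (mul_ne_zero (by norm_num) hc)]
    exact le_top
  have hz0 : ‖q.eval (z₀ : ℂ)‖ₑ ≠ 0 := by simpa using h0
  -- The exponent is `1/16 = 1/2 · 1/8`: `|z - ζ|^(-1/2)` is integrable on the circle, and `1/8` is
  -- the Hölder weight of each of the eight factors. The factor `(6 ^ 8) ^ (1/16) = 6 ^ (1/2)` is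
  -- rounded up to `6`.
  have hpt : ∀ z : Circle, ‖q.eval (z : ℂ)‖ₑ ^ (-(1 / 16) : ℝ) ≤
      (6 * ‖q.eval (z₀ : ℂ)‖ₑ ^ (-(1 / 16) : ℝ)) *
        ∏ i, (‖(z : ℂ) - ζ i‖ₑ ^ (-(1 / 2) : ℝ)) ^ (1 / 8 : ℝ) := by
    intro z
    have h1 : ‖q.eval (z₀ : ℂ)‖ₑ * ∏ i, ‖(z : ℂ) - ζ i‖ₑ ≤ 6 ^ 8 * ‖q.eval (z : ℂ)‖ₑ := by
      have h2 := ENNReal.ofReal_le_ofReal (hζ z₀ z)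
      rw [ENNReal.ofReal_mul (norm_nonneg _), ENNReal.ofReal_mul (by positivity),
        ENNReal.ofReal_prod_of_nonneg (fun _ _ => norm_nonneg _)] at h2
      simpa [ofReal_norm, ENNReal.ofReal_pow] using h2
    have h3 := ennreal_rpow_neg_le h1 (s := 1 / 16) (by norm_num)
    have hpz : ∏ i, ‖(z : ℂ) - ζ i‖ₑ ≠ ⊤ := ENNReal.prod_ne_top (by simp)
    rw [ENNReal.mul_rpow_of_ne_top (by simp) (by simp),
      ENNReal.mul_rpow_of_ne_top (by simp) hpz] at h3
    have h5 : (∏ i, ‖(z : ℂ) - ζ i‖ₑ) ^ (-(1 / 16) : ℝ) =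
        ∏ i, (‖(z : ℂ) - ζ i‖ₑ ^ (-(1 / 2) : ℝ)) ^ (1 / 8 : ℝ) := by
      rw [← ENNReal.prod_rpow_of_ne_top (by simp)]
      refine Finset.prod_congr rfl fun i _ => ?_
      rw [← ENNReal.rpow_mul]
      norm_num
    rw [h5] at h3
    have h6 : (1 : ENNReal) ≤ 6 * ((6 : ENNReal) ^ 8) ^ (-(1 / 16) : ℝ) := by
      have h7 : ((6 : ENNReal) ^ 8) ^ (-(1 / 16) : ℝ) = 6 ^ (-(1 / 2) : ℝ) := by
        rw [← ENNReal.rpow_natCast, ← ENNReal.rpow_mul]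
        norm_num
      rw [h7]
      calc (1 : ENNReal) ≤ 6 ^ (1 / 2 : ℝ) := ENNReal.one_le_rpow (by norm_num) (by norm_num)
        _ = 6 ^ ((1 : ℝ) + -(1 / 2)) := by norm_num
        _ = _ := by rw [ENNReal.rpow_add _ _ (by norm_num) (by norm_num), ENNReal.rpow_one]
    calc ‖q.eval (z : ℂ)‖ₑ ^ (-(1 / 16) : ℝ)
        = 1 * ‖q.eval (z : ℂ)‖ₑ ^ (-(1 / 16) : ℝ) := (one_mul _).symm
      _ ≤ (6 * ((6 : ENNReal) ^ 8) ^ (-(1 / 16) : ℝ)) * ‖q.eval (z : ℂ)‖ₑ ^ (-(1 / 16) : ℝ) := by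
          gcongr
      _ ≤ 6 * (‖q.eval (z₀ : ℂ)‖ₑ ^ (-(1 / 16) : ℝ) *
        ∏ i, (‖(z : ℂ) - ζ i‖ₑ ^ (-(1 / 2) : ℝ)) ^ (1 / 8 : ℝ)) := by
          rw [mul_assoc]
          gcongr
      _ = _ := (mul_assoc _ _ _).symm
  refine (lintegral_mono fun x => hpt (AddCircle.toCircle x)).trans ?_
  rw [lintegral_const_mul' _ _ (ENNReal.mul_ne_top (by norm_num)
    (by simp [ENNReal.rpow_eq_top_iff, h0])), mul_right_comm]
  gcongr
  have h4 := ENNReal.lintegral_prod_norm_pow_le (μ := (volume : Measure UnitAddCircle))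
    (Finset.univ : Finset (Fin 8))
    (f := fun i x => ‖((AddCircle.toCircle x : Circle) : ℂ) - ζ i‖ₑ ^ (-(1 / 2) : ℝ))
    (fun i _ => (measurable_circle_sub_rpow (ζ i) _).aemeasurable) (p := fun _ => 1 / 8)
    (by simp) (by simp)
  simp only [lintegral_circle_sub] at h4
  rw [Finset.prod_const, Finset.card_univ, Fintype.card_fin, ← ENNReal.rpow_natCast,
    ← ENNReal.rpow_mul] at h4
  simpa using h4

/-! ### Negative moments of polynomials on the unitary group -/

/-- Continuous functions on the unitary group whose modulus along every circle `z ↦ A + z B` is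
that of a polynomial in `z` of degree at most `8`. -/
def IsCirclePolynomial {k : ℕ} (p : Gate k → ℂ) : Prop :=
  Continuous p ∧ ∀ A B : QMatrix (Fin k), ∃ q : Polynomial ℂ, q.natDegree ≤ 8 ∧
    ∀ (g : Gate k) (z : Circle), (g : QMatrix (Fin k)) = A + (z : ℂ) • B →
      ‖p g‖ = ‖q.eval (z : ℂ)‖

/-- For some probability measure, the negative moments of circle polynomials are controlled by
their values at an arbitrary point of `K`. -/
def ControlsMoments {k : ℕ} (K : Set (Gate k)) : Prop :=
  ∃ μ : Measure (Gate k), IsProbabilityMeasure μ ∧ ∃ C : ENNReal, C ≠ ⊤ ∧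
    ∀ p : Gate k → ℂ, IsCirclePolynomial p → ∀ u ∈ K,
      ∫⁻ v, ‖p v‖ₑ ^ (-(1 / 16) : ℝ) ∂μ ≤ C * ‖p u‖ₑ ^ (-(1 / 16) : ℝ)

instance instSecondCountableTopologyGate : SecondCountableTopology (Gate k) :=
  haveI : SecondCountableTopology (QMatrix (Fin k)) :=
    inferInstanceAs (SecondCountableTopology ((Fin k → Fin 2) → (Fin k → Fin 2) → ℂ))
  TopologicalSpace.Subtype.secondCountableTopology _

theorem IsCirclePolynomial.measurable {p : Gate k → ℂ} (hp : IsCirclePolynomial p) :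
    Measurable fun v => ‖p v‖ₑ ^ (-(1 / 16) : ℝ) :=
  hp.1.measurable.enorm.pow_const _

theorem IsCirclePolynomial.mul_left {p : Gate k → ℂ} (hp : IsCirclePolynomial p) (u : Gate k) :
    IsCirclePolynomial fun v => p (u * v) := by
  refine ⟨hp.1.comp (continuous_const_mul u), fun A B => ?_⟩
  obtain ⟨q, hq, h⟩ := hp.2 ((u : QMatrix (Fin k)) * A) ((u : QMatrix (Fin k)) * B)
  refine ⟨q, hq, fun g z hg => h _ z ?_⟩
  rw [Submonoid.coe_mul, hg, mul_add, mul_smul_comm]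

theorem IsCirclePolynomial.mul_right {p : Gate k → ℂ} (hp : IsCirclePolynomial p) (u : Gate k) :
    IsCirclePolynomial fun v => p (v * u) := by
  refine ⟨hp.1.comp (continuous_mul_const u), fun A B => ?_⟩
  obtain ⟨q, hq, h⟩ := hp.2 (A * (u : QMatrix (Fin k))) (B * (u : QMatrix (Fin k)))
  refine ⟨q, hq, fun g z hg => h _ z ?_⟩
  rw [Submonoid.coe_mul, hg, add_mul, smul_mul_assoc]

theorem ControlsMoments.mono {K K' : Set (Gate k)} (h : ControlsMoments K') (hK : K ⊆ K') :
    ControlsMoments K := by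
  obtain ⟨μ, hμ, C, hC, h⟩ := h
  exact ⟨μ, hμ, C, hC, fun p hp u hu => h p hp u (hK hu)⟩

theorem controlsMoments_one : ControlsMoments ({1} : Set (Gate k)) := by
  refine ⟨Measure.dirac 1, inferInstance, 1, by simp, fun p hp u hu => ?_⟩
  rw [Set.mem_singleton_iff.mp hu, lintegral_dirac' _ hp.measurable, one_mul]

open Pointwise in
-- The convolution of the two measures works: translates of circle polynomials are circle
-- polynomials, so the two factors can be integrated one at a time.
theorem ControlsMoments.mul {K K' : Set (Gate k)} (h : ControlsMoments K)
    (h' : ControlsMoments K') : ControlsMoments (K * K') := by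
  obtain ⟨μ, hμ, C, hC, h⟩ := h
  obtain ⟨μ', hμ', C', hC', h'⟩ := h'
  refine ⟨μ ∗ₘ μ', inferInstance, C' * C, ENNReal.mul_ne_top hC' hC, fun p hp u hu => ?_⟩
  obtain ⟨x, hx, y, hy, rfl⟩ := Set.mem_mul.mp hu
  rw [Measure.lintegral_mconv hp.measurable]
  calc ∫⁻ v, ∫⁻ w, ‖p (v * w)‖ₑ ^ (-(1 / 16) : ℝ) ∂μ' ∂μ
      ≤ ∫⁻ v, C' * ‖p (v * y)‖ₑ ^ (-(1 / 16) : ℝ) ∂μ :=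
        lintegral_mono fun v => h' _ (hp.mul_left v) y hy
    _ = C' * ∫⁻ v, ‖p (v * y)‖ₑ ^ (-(1 / 16) : ℝ) ∂μ := lintegral_const_mul' _ _ hC'
    _ ≤ C' * (C * ‖p (x * y)‖ₑ ^ (-(1 / 16) : ℝ)) := by
        gcongr
        exact h _ (hp.mul_right y) x hx
    _ = _ := (mul_assoc _ _ _).symm

/-- The unitary gate `1 + (z - 1) Q`, for an orthogonal projection `Q`. -/
def phaseGate (Q : QMatrix (Fin k)) (hQ : Qᴴ = Q) (hQ' : Q * Q = Q) (z : Circle) : Gate k :=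
  ⟨1 + ((z : ℂ) - 1) • Q, by
    have hz : (z : ℂ) * star (z : ℂ) = 1 := by
      rw [Complex.star_def, Complex.mul_conj, Circle.normSq_coe, Complex.ofReal_one]
    rw [Matrix.mem_unitaryGroup_iff, star_add, star_one, star_smul, Matrix.star_eq_conjTranspose,
      hQ, add_mul, mul_add, mul_add, one_mul, one_mul, mul_one, smul_mul_smul_comm, hQ',
      add_assoc, ← add_smul, ← add_smul, star_sub, star_one]
    have : star (z : ℂ) - 1 + ((z : ℂ) - 1 + ((z : ℂ) - 1) * (star (z : ℂ) - 1)) = 0 := by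
      linear_combination hz
    rw [this, zero_smul, add_zero]⟩

theorem coe_phaseGate (Q : QMatrix (Fin k)) (hQ : Qᴴ = Q) (hQ' : Q * Q = Q) (z : Circle) :
    (phaseGate Q hQ hQ' z : QMatrix (Fin k)) = 1 + ((z : ℂ) - 1) • Q := rfl

theorem phaseGate_mulVec (Q : QMatrix (Fin k)) (hQ : Qᴴ = Q) (hQ' : Q * Q = Q) (z : Circle)
    (v : (Fin k → Fin 2) → ℂ) :
    (phaseGate Q hQ hQ' z : QMatrix (Fin k)) *ᵥ v = v + ((z : ℂ) - 1) • Q *ᵥ v := by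
  rw [coe_phaseGate, Matrix.add_mulVec, Matrix.one_mulVec, Matrix.smul_mulVec]

theorem phaseGate_mul_inv (Q : QMatrix (Fin k)) (hQ : Qᴴ = Q) (hQ' : Q * Q = Q) (z : Circle) :
    (phaseGate Q hQ hQ' z : QMatrix (Fin k)) * phaseGate Q hQ hQ' z⁻¹ = 1 := by
  have hz : (z : ℂ) * ((z⁻¹ : Circle) : ℂ) = 1 := by
    rw [← Circle.coe_mul, mul_inv_cancel, Circle.coe_one]
  rw [coe_phaseGate, coe_phaseGate, add_mul, mul_add, mul_add, one_mul, one_mul, mul_one,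
    smul_mul_smul_comm, hQ', add_assoc, ← add_smul, ← add_smul]
  have : ((z⁻¹ : Circle) : ℂ) - 1 + ((z : ℂ) - 1 + ((z : ℂ) - 1) * (((z⁻¹ : Circle) : ℂ) - 1)) =
      0 := by
    linear_combination hz
  rw [this, zero_smul, add_zero]

/-- The gates form the circle `(1 - Q) + z Q`, on which the modulus of a circle polynomial is that
of one polynomial in `z`. -/
theorem controlsMoments_phaseGate (Q : QMatrix (Fin k)) (hQ : Qᴴ = Q) (hQ' : Q * Q = Q) :
    ControlsMoments (Set.range (phaseGate Q hQ hQ')) := by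
  have hc : Continuous fun x : UnitAddCircle => phaseGate Q hQ hQ' (AddCircle.toCircle x) := by
    refine Continuous.subtype_mk ?_ _
    exact continuous_const.add ((continuous_coe_toCircle.sub continuous_const).smul
      continuous_const)
  refine ⟨(volume : Measure UnitAddCircle).map fun x => phaseGate Q hQ hQ' (AddCircle.toCircle x),
    Measure.isProbabilityMeasure_map hc.measurable.aemeasurable, 6 * circleConst,
    ENNReal.mul_ne_top (by norm_num) circleConst_ne_top, ?_⟩
  rintro p hp _ ⟨z, rfl⟩
  obtain ⟨q, hq, h⟩ := hp.2 (1 - Q) Q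
  have h' : ∀ z : Circle, ‖p (phaseGate Q hQ hQ' z)‖ₑ = ‖q.eval (z : ℂ)‖ₑ := fun z => by
    rw [← ofReal_norm, ← ofReal_norm, h (phaseGate Q hQ hQ' z) z]
    rw [coe_phaseGate, sub_smul, one_smul]
    abel
  rw [lintegral_map hp.measurable hc.measurable]
  simp only [h']
  exact lintegral_circle_polynomial_le q hq z

/-! ### Generation of the unitary group by circles -/

/-- The projection onto the `j`-th basis vector. -/
def basisProj (j : Fin k → Fin 2) : QMatrix (Fin k) := Matrix.single j j 1

theorem basisProj_conjTranspose (j : Fin k → Fin 2) : (basisProj j)ᴴ = basisProj j := by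
  simp [basisProj, Matrix.conjTranspose_single]

theorem basisProj_mul_self (j : Fin k → Fin 2) : basisProj j * basisProj j = basisProj j := by
  simp [basisProj]

theorem basisProj_mulVec (j : Fin k → Fin 2) (v : (Fin k → Fin 2) → ℂ) :
    basisProj j *ᵥ v = Pi.single j (v j) := by
  ext i
  simp [basisProj, Matrix.single_mulVec, Pi.single_apply, Function.update_apply]

/-- The projection onto the span of the difference of two basis vectors. -/
def diffProj (j l : Fin k → Fin 2) : QMatrix (Fin k) :=
  (1 / 2 : ℂ) • (Matrix.single j j 1 - Matrix.single j l 1 - Matrix.single l j 1 +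
    Matrix.single l l 1)

theorem diffProj_conjTranspose (j l : Fin k → Fin 2) : (diffProj j l)ᴴ = diffProj j l := by
  simp only [diffProj, Matrix.conjTranspose_smul, Matrix.conjTranspose_add,
    Matrix.conjTranspose_sub, Matrix.conjTranspose_single, star_one]
  rw [show star (1 / 2 : ℂ) = 1 / 2 by simp]
  congr 2
  abel

theorem diffProj_mul_self {j l : Fin k → Fin 2} (hjl : j ≠ l) :
    diffProj j l * diffProj j l = diffProj j l := by
  simp only [diffProj, smul_mul_smul_comm, mul_add, mul_sub, add_mul, sub_mul,
    Matrix.single_mul_single_same, Matrix.single_mul_single_of_ne, hjl, hjl.symm, ne_eq,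
    not_false_eq_true, mul_one]
  ext a b
  simp only [Matrix.smul_apply, Matrix.add_apply, Matrix.sub_apply, Matrix.zero_apply, smul_eq_mul]
  ring

theorem diffProj_mulVec (j l : Fin k → Fin 2) (v : (Fin k → Fin 2) → ℂ) :
    diffProj j l *ᵥ v = ((v j - v l) / 2) • (Pi.single j 1 - Pi.single l 1) := by
  ext i
  simp [diffProj, Matrix.smul_mulVec, Matrix.add_mulVec, Matrix.sub_mulVec,
    Matrix.single_mulVec, Pi.single_apply, Function.update_apply]
  split_ifs <;> ring

/-- Choose `y` so that `y b` is orthogonal to `a` in the real plane. Then `|a + y b| = |a - y b|`,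
so the solution `z = (a + y b) / (a - y b)` lies on the circle. Half of the left side is the
coordinate `l` left after a phase `y` on basis vector `l` and a phase `z` along `diffProj j l`,
where `a`, `b` are the coordinates `j`, `l`. -/
theorem exists_rotation_phases (a b : ℂ) :
    ∃ y z : Circle, (1 + (z : ℂ)) * ((y : ℂ) * b) + (1 - z) * a = 0 := by
  obtain ⟨ζ, hζ⟩ : ∃ ζ : Circle, a * star b = ‖a * star b‖ * (ζ : ℂ) :=
    ⟨Circle.exp (a * star b).arg, by rw [Circle.coe_exp, Complex.norm_mul_exp_arg_mul_I]⟩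
  obtain ⟨y, hy⟩ : ∃ y : Circle, (y : ℂ) = Complex.I * ζ :=
    ⟨⟨Complex.I * ζ, mem_sphere_zero_iff_norm.mpr (by
      rw [norm_mul, Complex.norm_I, Circle.norm_coe, one_mul])⟩, rfl⟩
  have hre : (a * star ((y : ℂ) * b)).re = 0 := by
    have hz : (ζ : ℂ) * star (ζ : ℂ) = 1 := by
      rw [Complex.star_def, Complex.mul_conj, Circle.normSq_coe, Complex.ofReal_one]
    have : a * star ((y : ℂ) * b) = -Complex.I * (‖a * star b‖ : ℝ) := by
      rw [hy, star_mul', star_mul', show star Complex.I = -Complex.I from Complex.conj_I]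
      linear_combination (-Complex.I * star (ζ : ℂ)) * hζ - Complex.I * (‖a * star b‖ : ℝ) * hz
    rw [this]
    simp
  have hn : ‖a + y * b‖ = ‖a - y * b‖ := by
    rw [← sq_eq_sq₀ (norm_nonneg _) (norm_nonneg _), Complex.sq_norm, Complex.sq_norm,
      Complex.normSq_add, Complex.normSq_sub]
    rw [Complex.star_def] at hre
    rw [hre]
    ring
  refine ⟨y, ?_⟩
  by_cases h : a - y * b = 0
  · refine ⟨1, ?_⟩
    rw [h, norm_zero, norm_eq_zero] at hn
    simp only [Circle.coe_one]
    linear_combination hn - h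
  · refine ⟨⟨(a + y * b) / (a - y * b), ?_⟩, ?_⟩
    · refine mem_sphere_zero_iff_norm.mpr ?_
      rw [norm_div, hn, div_self (norm_ne_zero_iff.mpr h)]
    · simp only
      field_simp
      ring

open Pointwise in
-- Elimination of one column: each `l ∈ T` contributes two circles, which suffice to clear
-- coordinate `l` against coordinate `j`. The inverse of a phase gate lies on the same circle, so
-- undoing the elimination writes `v` as required.
theorem exists_controlsMoments_of_support (j : Fin k → Fin 2) (T : Finset (Fin k → Fin 2))
    (hj : j ∉ T) :
    ∃ W : Set (Gate k), ControlsMoments W ∧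
      (∀ w ∈ W, ∀ i, i ∉ insert j T → (w : QMatrix (Fin k)) *ᵥ Pi.single i 1 = Pi.single i 1) ∧
      ∀ v : (Fin k → Fin 2) → ℂ, (∀ i, i ∉ insert j T → v i = 0) →
        ∃ w ∈ W, ∃ c : ℂ, v = (w : QMatrix (Fin k)) *ᵥ Pi.single j c := by
  induction T using Finset.induction_on with
  | empty =>
    refine ⟨{1}, controlsMoments_one, ?_, fun v hv => ⟨1, rfl, v j, ?_⟩⟩
    · rintro w rfl i -
      rw [OneMemClass.coe_one, Matrix.one_mulVec]
    · ext i
      rw [OneMemClass.coe_one, Matrix.one_mulVec]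
      by_cases hi : i = j
      · subst hi; simp
      · rw [hv i (by simpa using hi), Pi.single_eq_of_ne hi]
  | insert l T hl ih =>
    have hjl : j ≠ l := fun h => hj (h ▸ Finset.mem_insert_self _ _)
    obtain ⟨W, hW, hfix, hsup⟩ := ih fun h => hj (Finset.mem_insert_of_mem h)
    refine ⟨Set.range (phaseGate _ (basisProj_conjTranspose l) (basisProj_mul_self l)) *
      Set.range (phaseGate _ (diffProj_conjTranspose j l) (diffProj_mul_self hjl)) * W,
      ((controlsMoments_phaseGate _ _ _).mul (controlsMoments_phaseGate _ _ _)).mul hW, ?_, ?_⟩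
    · rintro _ ⟨_, ⟨_, ⟨y, rfl⟩, _, ⟨z, rfl⟩, rfl⟩, w, hw, rfl⟩ i hi
      have hi1 : i ≠ j := fun h => hi (by simp [h])
      have hi2 : i ≠ l := fun h => hi (by simp [h])
      have hi3 : i ∉ insert j T := fun h => hi (by
        rw [Finset.mem_insert] at h ⊢
        exact h.imp id Finset.mem_insert_of_mem)
      simp only [Submonoid.coe_mul, ← Matrix.mulVec_mulVec, hfix w hw i hi3, phaseGate_mulVec,
        diffProj_mulVec, basisProj_mulVec, Pi.single_eq_of_ne hi1.symm,
        Pi.single_eq_of_ne hi2.symm, sub_zero, zero_div, zero_smul, smul_zero, add_zero,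
        Pi.single_zero]
    · intro v hv
      obtain ⟨y, z, hyz⟩ := exists_rotation_phases (v j) (v l)
      set Y := phaseGate _ (basisProj_conjTranspose l) (basisProj_mul_self l) with hY
      set Z := phaseGate _ (diffProj_conjTranspose j l) (diffProj_mul_self hjl) with hZ
      set v' := (Z z : QMatrix (Fin k)) *ᵥ ((Y y : QMatrix (Fin k)) *ᵥ v) with hv'
      have hval : ∀ i, v' i = if i = l then 0 else if i = j then v' j else v i := by
        intro i
        split_ifs with h1 h2
        · subst h1
          simp only [hv', hY, hZ, phaseGate_mulVec, diffProj_mulVec, basisProj_mulVec,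
            Pi.add_apply, Pi.smul_apply, Pi.sub_apply, Pi.single_eq_same, smul_eq_mul,
            Pi.single_eq_of_ne hjl, Pi.single_eq_of_ne hjl.symm]
          linear_combination (1 / 2 : ℂ) * hyz
        · rw [h2]
        · simp [hv', hY, hZ, phaseGate_mulVec, diffProj_mulVec, basisProj_mulVec,
            Pi.single_eq_of_ne h1, Pi.single_eq_of_ne h2]
      obtain ⟨w, hw, c, hc⟩ := hsup v' fun i hi => by
        rw [hval i]
        split_ifs with h1 h2
        · rfl
        · exact absurd (by simp [h2]) hi
        · refine hv i ?_
          simp only [Finset.mem_insert, not_or] at hi ⊢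
          exact ⟨h2, h1, hi.2⟩
      refine ⟨Y y⁻¹ * Z z⁻¹ * w, ⟨_, ⟨_, ⟨_, rfl⟩, _, ⟨_, rfl⟩, rfl⟩, w, hw, rfl⟩, c, ?_⟩
      have h1 : (Y y⁻¹ : QMatrix (Fin k)) * Y y = 1 := by
        simpa using phaseGate_mul_inv _ (basisProj_conjTranspose l) (basisProj_mul_self l) y⁻¹
      have h2 : (Z z⁻¹ : QMatrix (Fin k)) * Z z = 1 := by
        simpa using phaseGate_mul_inv _ (diffProj_conjTranspose j l) (diffProj_mul_self hjl) z⁻¹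
      simp only [Submonoid.coe_mul, ← Matrix.mulVec_mulVec]
      rw [← hc, hv', Matrix.mulVec_mulVec _ (Z z⁻¹ : QMatrix (Fin k)), h2, Matrix.one_mulVec,
        Matrix.mulVec_mulVec, h1, Matrix.one_mulVec]

theorem gate_conjTranspose_mul (U : Gate k) :
    (U : QMatrix (Fin k))ᴴ * (U : QMatrix (Fin k)) = 1 :=
  Matrix.mem_unitaryGroup_iff'.mp U.2

theorem star_dotProduct_gate_mulVec (U : Gate k) (v w : (Fin k → Fin 2) → ℂ) :
    star ((U : QMatrix (Fin k)) *ᵥ v) ⬝ᵥ ((U : QMatrix (Fin k)) *ᵥ w) = star v ⬝ᵥ w := by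
  rw [Matrix.star_mulVec, ← Matrix.dotProduct_mulVec, Matrix.mulVec_mulVec,
    gate_conjTranspose_mul, Matrix.one_mulVec]

open Pointwise in
-- Induction on the number of basis vectors that may move. Column `j` of `U` is produced by an
-- element of `W` and a phase on basis vector `j`; after dividing by these, the gate also fixes
-- basis vector `j`.
theorem controlsMoments_fixing (S : Finset (Fin k → Fin 2)) :
    ControlsMoments {U : Gate k |
      ∀ i ∉ S, (U : QMatrix (Fin k)) *ᵥ Pi.single i 1 = Pi.single i 1} := by
  induction S using Finset.induction_on with
  | empty =>
    refine controlsMoments_one.mono fun U hU => ?_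
    refine Subtype.ext (Matrix.ext_of_mulVec_single fun i => ?_)
    rw [hU i (by simp), OneMemClass.coe_one, Matrix.one_mulVec]
  | insert j S hj ih =>
    obtain ⟨W, hW, hfix, hsup⟩ := exists_controlsMoments_of_support j S hj
    refine ((hW.mul (controlsMoments_phaseGate _ (basisProj_conjTranspose j)
      (basisProj_mul_self j))).mul ih).mono fun U hU => ?_
    -- Column `j` is orthogonal to the fixed basis vectors, hence supported on `insert j S`.
    obtain ⟨w, hw, c, hc⟩ := hsup ((U : QMatrix (Fin k)) *ᵥ Pi.single j 1) fun i hi => by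
      have h1 := star_dotProduct_gate_mulVec U (Pi.single i 1) (Pi.single j 1)
      have hij : i ≠ j := fun h => hi (by simp [h])
      rw [hU i hi, Pi.star_single, star_one, single_one_dotProduct, single_one_dotProduct,
        Pi.single_eq_of_ne hij] at h1
      exact h1
    have hcn : ‖c‖ = 1 := by
      have h1 := star_dotProduct_gate_mulVec U (Pi.single j 1) (Pi.single j 1)
      rw [hc, star_dotProduct_gate_mulVec] at h1
      simp only [Pi.star_single, star_one, single_dotProduct, Pi.single_eq_same, one_mul] at h1
      rw [Complex.star_def, mul_comm, Complex.mul_conj, Complex.normSq_eq_norm_sq] at h1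
      have h2 : ‖c‖ ^ 2 = 1 := by exact_mod_cast h1
      exact (pow_eq_one_iff_of_nonneg (norm_nonneg c) two_ne_zero).mp h2
    obtain ⟨z, hz⟩ : ∃ z : Circle, (z : ℂ) = c := ⟨⟨c, mem_sphere_zero_iff_norm.mpr hcn⟩, rfl⟩
    set Z := phaseGate _ (basisProj_conjTranspose j) (basisProj_mul_self j) with hZ
    have hZj : (Z z : QMatrix (Fin k)) *ᵥ Pi.single j 1 = Pi.single j c := by
      rw [hZ, phaseGate_mulVec, basisProj_mulVec, Pi.single_eq_same, hz, ← Pi.single_smul,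
        ← Pi.single_add]
      simp
    refine ⟨w * Z z, ⟨w, hw, _, ⟨z, rfl⟩, rfl⟩, (w * Z z)⁻¹ * U, fun i hi => ?_,
      mul_inv_cancel_left _ _⟩
    have key : (U : QMatrix (Fin k)) *ᵥ Pi.single i 1 =
        ((w * Z z : Gate k) : QMatrix (Fin k)) *ᵥ Pi.single i 1 := by
      rw [Submonoid.coe_mul, ← Matrix.mulVec_mulVec]
      by_cases hij : i = j
      · subst hij
        rw [hZj, hc]
      · have hi' : i ∉ insert j S := by simp [hij, hi]
        rw [hU i hi', hZ, phaseGate_mulVec, basisProj_mulVec,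
          Pi.single_eq_of_ne (Ne.symm hij), Pi.single_zero, smul_zero, add_zero,
          hfix w hw i hi']
    rw [Submonoid.coe_mul, ← Matrix.mulVec_mulVec, key, Matrix.mulVec_mulVec,
      ← Submonoid.coe_mul, inv_mul_cancel, OneMemClass.coe_one, Matrix.one_mulVec]

theorem controlsMoments_univ : ControlsMoments (Set.univ : Set (Gate k)) :=
  (controlsMoments_fixing Finset.univ).mono fun _ _ i hi => absurd (Finset.mem_univ i) hi

/-! ### Gates as operators on all qubits -/

/-- The operator `M` on the qubits `pos 0, …, pos (k - 1)`, tensored with the identity. -/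
def localOp (pos : Fin k ↪ Fin n) (M : QMatrix (Fin k)) : QMatrix (Fin n) :=
  Matrix.of fun x y =>
    if ∀ q, (∀ i, pos i ≠ q) → x q = y q then M (x ∘ pos) (y ∘ pos) else 0

theorem gateOp_eq_localOp (pos : Fin k ↪ Fin n) (G : Gate k) :
    gateOp pos G = localOp pos (G : QMatrix (Fin k)) := rfl

theorem localOp_apply (pos : Fin k ↪ Fin n) (M : QMatrix (Fin k)) (x y : Fin n → Fin 2) :
    localOp pos M x y =
      if ∀ q, (∀ i, pos i ≠ q) → x q = y q then M (x ∘ pos) (y ∘ pos) else 0 := rfl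

theorem localOp_add_smul (pos : Fin k ↪ Fin n) (M N : QMatrix (Fin k)) (z : ℂ) :
    localOp pos (M + z • N) = localOp pos M + z • localOp pos N := by
  ext x y
  simp only [localOp_apply, Matrix.add_apply, Matrix.smul_apply]
  split_ifs <;> simp

/-- Row `x` lives on the bit strings agreeing with `x` off `pos`; these are parametrised by their
restriction to `pos`. -/
theorem sum_localOp_mul (pos : Fin k ↪ Fin n) (M : QMatrix (Fin k)) (x : Fin n → Fin 2)
    (f : (Fin n → Fin 2) → ℂ) :
    ∑ z, localOp pos M x z * f z = ∑ w, M (x ∘ pos) w * f (Function.extend pos w x) := by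
  symm
  refine Finset.sum_of_injOn (fun w => Function.extend pos w x) ?_ (by simp) ?_ ?_
  · intro w _ w' _ h
    funext i
    have := congrFun h (pos i)
    simpa only [pos.injective.extend_apply] using this
  · intro z _ hz
    rw [localOp_apply, if_neg, zero_mul]
    intro h
    refine hz ⟨z ∘ pos, by simp, ?_⟩
    funext q
    by_cases hq : ∃ i, pos i = q
    · obtain ⟨i, rfl⟩ := hq
      simp only [pos.injective.extend_apply, Function.comp_apply]
    · simp only [Function.extend_apply' _ _ _ hq]
      exact h q fun i hi => hq ⟨i, hi⟩
  · intro w _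
    rw [localOp_apply, if_pos]
    · congr 2
      funext i
      simp only [Function.comp_apply, pos.injective.extend_apply]
    · intro q hq
      rw [Function.extend_apply' _ _ _ fun ⟨i, hi⟩ => hq i hi]

theorem localOp_mul (pos : Fin k ↪ Fin n) (M N : QMatrix (Fin k)) :
    localOp pos M * localOp pos N = localOp pos (M * N) := by
  ext x y
  rw [Matrix.mul_apply, sum_localOp_mul, localOp_apply]
  have h1 : ∀ w : Fin k → Fin 2, Function.extend pos w x ∘ pos = w := fun w => by
    funext i
    simp only [Function.comp_apply, pos.injective.extend_apply]
  have h2 : ∀ w : Fin k → Fin 2, (∀ q, (∀ i, pos i ≠ q) → Function.extend pos w x q = y q) ↔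
      ∀ q, (∀ i, pos i ≠ q) → x q = y q := fun w => by
    refine forall_congr' fun q => forall_congr' fun hq => ?_
    rw [Function.extend_apply' _ _ _ fun ⟨i, hi⟩ => hq i hi]
  simp only [localOp_apply, h1, h2, Matrix.mul_apply]
  split_ifs <;> simp

theorem localOp_one (pos : Fin k ↪ Fin n) : localOp pos 1 = 1 := by
  ext x y
  rw [localOp_apply, Matrix.one_apply, Matrix.one_apply]
  by_cases h : x = y
  · subst h
    simp
  · rw [if_neg h]
    split_ifs with h1 h2
    · refine absurd (funext fun q => ?_) h
      by_cases hq : ∃ i, pos i = q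
      · obtain ⟨i, rfl⟩ := hq
        exact congrFun h2 i
      · exact h1 q fun i hi => hq ⟨i, hi⟩
    · rfl
    · rfl

theorem localOp_conjTranspose (pos : Fin k ↪ Fin n) (M : QMatrix (Fin k)) :
    (localOp pos M)ᴴ = localOp pos Mᴴ := by
  ext x y
  simp only [Matrix.conjTranspose_apply, localOp_apply, eq_comm (a := x _)]
  split_ifs <;> simp

theorem gateOp_conjTranspose_mul (pos : Fin k ↪ Fin n) (G : Gate k) :
    (gateOp pos G)ᴴ * gateOp pos G = 1 := by
  rw [gateOp_eq_localOp, localOp_conjTranspose, localOp_mul, gate_conjTranspose_mul, localOp_one]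

/-! ### Reduced states -/

theorem reduceTo_apply (q : Fin n) (σ : QMatrix (Fin n)) (s t : Fin 2) :
    reduceTo q σ s t = ∑ x, if x q = s then σ x (Function.update x q t) else 0 := by
  rw [reduceTo, Matrix.of_apply, ← (Equiv.funSplitAt q (Fin 2)).symm.sum_comp,
    Fintype.sum_prod_type, Finset.sum_comm]
  refine Finset.sum_congr rfl fun z _ => ?_
  have h1 : ∀ u, (Equiv.funSplitAt q (Fin 2)).symm (u, z) q = u := fun u => by simp
  have h2 : ∀ u, Function.update ((Equiv.funSplitAt q (Fin 2)).symm (u, z)) q t =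
      (Equiv.funSplitAt q (Fin 2)).symm (t, z) := fun u => by
    funext p
    by_cases hp : p = q
    · subst hp; simp
    · simp [hp]
  simp only [h1, h2, Finset.sum_ite_eq', Finset.mem_univ, if_true]

/-- The matrix unit `|s⟩⟨t|` on qubit `q`, tensored with the identity. -/
def siteOp (q : Fin n) (s t : Fin 2) : QMatrix (Fin n) :=
  Matrix.of fun x y => if x q = s ∧ y = Function.update x q t then 1 else 0

theorem siteOp_apply' (q : Fin n) (s t : Fin 2) (x y : Fin n → Fin 2) :
    siteOp q s t x y = if y q = t ∧ x = Function.update y q s then 1 else 0 := by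
  rw [siteOp, Matrix.of_apply]
  refine if_congr ⟨?_, ?_⟩ rfl rfl <;>
  · rintro ⟨rfl, rfl⟩
    simp

theorem reduceTo_eq_trace (q : Fin n) (σ : QMatrix (Fin n)) (s t : Fin 2) :
    reduceTo q σ s t = (σ * siteOp q t s).trace := by
  rw [reduceTo_apply, Matrix.trace]
  refine Finset.sum_congr rfl fun x _ => ?_
  rw [Matrix.diag_apply, Matrix.mul_apply]
  simp only [siteOp_apply', ite_and, mul_ite, mul_one, mul_zero]
  split_ifs
  · simp
  · simp

theorem localOp_mul_siteOp (pos : Fin k ↪ Fin n) (M : QMatrix (Fin k)) (q : Fin n)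
    (hq : ∀ i, pos i ≠ q) (s t : Fin 2) :
    localOp pos M * siteOp q s t = siteOp q s t * localOp pos M := by
  ext x y
  have hu : ∀ (v : Fin n → Fin 2) (u : Fin 2), Function.update v q u ∘ pos = v ∘ pos :=
    fun v u => funext fun i => Function.update_of_ne (hq i) _ _
  have h1 : (localOp pos M * siteOp q s t) x y =
      if y q = t then localOp pos M x (Function.update y q s) else 0 := by
    rw [Matrix.mul_apply]
    simp only [siteOp_apply', ite_and, mul_ite, mul_one, mul_zero]
    split_ifs <;> simp
  have h2 : (siteOp q s t * localOp pos M) x y =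
      if x q = s then localOp pos M (Function.update x q t) y else 0 := by
    rw [Matrix.mul_apply]
    simp only [siteOp, Matrix.of_apply, ite_and, ite_mul, one_mul, zero_mul]
    split_ifs <;> simp
  rw [h1, h2, localOp_apply, localOp_apply, hu, hu, ← ite_and, ← ite_and]
  refine if_congr ⟨?_, ?_⟩ rfl rfl
  · rintro ⟨h, h'⟩
    refine ⟨by simpa using h' q hq, fun p hp => ?_⟩
    by_cases hpq : p = q
    · subst hpq; simp [h]
    · simpa [Function.update_of_ne hpq] using h' p hp
  · rintro ⟨h, h'⟩
    refine ⟨by simpa using (h' q hq).symm, fun p hp => ?_⟩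
    by_cases hpq : p = q
    · subst hpq; simp [h]
    · simpa [Function.update_of_ne hpq] using h' p hp

/-- A gate that does not act on a qubit does not change its reduced state. -/
theorem reduceTo_gateOp_of_forall_ne (pos : Fin k ↪ Fin n) (G : Gate k) (q : Fin n)
    (hq : ∀ i, pos i ≠ q) (σ : QMatrix (Fin n)) :
    reduceTo q (gateOp pos G * σ * (gateOp pos G)ᴴ) = reduceTo q σ := by
  ext s t
  rw [reduceTo_eq_trace, reduceTo_eq_trace, Matrix.mul_assoc, Matrix.mul_assoc,
    Matrix.trace_mul_comm, Matrix.mul_assoc, Matrix.mul_assoc, gateOp_eq_localOp,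
    ← localOp_mul_siteOp pos _ q hq, ← Matrix.mul_assoc _ _ (siteOp q t s), ← gateOp_eq_localOp,
    gateOp_conjTranspose_mul, Matrix.one_mul]

/-- The gate that exchanges two of its qubits. -/
def swapGate (i j : Fin k) : Gate k :=
  ⟨Matrix.of fun x y => if y = x ∘ Equiv.swap i j then 1 else 0, by
    rw [Matrix.mem_unitaryGroup_iff]
    ext x y
    rw [Matrix.mul_apply, Matrix.one_apply]
    simp only [Matrix.of_apply, Matrix.star_apply, ite_mul, one_mul, zero_mul,
      Finset.sum_ite_eq', Finset.mem_univ, if_true]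
    have : x ∘ Equiv.swap i j = y ∘ Equiv.swap i j ↔ x = y :=
      (Equiv.swap i j).surjective.injective_comp_right.eq_iff
    simp only [this]
    split_ifs <;> simp⟩

theorem gateOp_swapGate (pos : Fin k ↪ Fin n) (i j : Fin k) (x y : Fin n → Fin 2) :
    gateOp pos (swapGate i j) x y =
      if y = x ∘ Equiv.swap (pos i) (pos j) then 1 else 0 := by
  rw [gateOp_eq_localOp, localOp_apply, swapGate]
  simp only [Matrix.of_apply]
  rw [← ite_and]
  have hs : ∀ l, Equiv.swap (pos i) (pos j) (pos l) = pos (Equiv.swap i j l) := fun l =>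
    (pos.injective.map_swap i j l).symm
  refine if_congr ⟨?_, ?_⟩ rfl rfl
  · rintro ⟨h, h'⟩
    funext q
    by_cases hq : ∃ l, pos l = q
    · obtain ⟨l, rfl⟩ := hq
      rw [Function.comp_apply, hs]
      exact congrFun h' l
    · have hq' : ∀ l, pos l ≠ q := fun l hl => hq ⟨l, hl⟩
      rw [Function.comp_apply, Equiv.swap_apply_of_ne_of_ne (hq' i).symm (hq' j).symm, h q hq']
  · rintro rfl
    refine ⟨fun q hq => ?_, ?_⟩
    · rw [Function.comp_apply, Equiv.swap_apply_of_ne_of_ne (hq i).symm (hq j).symm]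
    · funext l
      simp only [Function.comp_apply, hs]

theorem reduceTo_swapGate (pos : Fin k ↪ Fin n) (i j : Fin k) (σ : QMatrix (Fin n)) :
    reduceTo (pos j) (gateOp pos (swapGate i j) * σ * (gateOp pos (swapGate i j))ᴴ) =
      reduceTo (pos i) σ := by
  set f := Equiv.swap (pos i) (pos j) with hf
  have h1 : ∀ x y, (gateOp pos (swapGate i j) * σ * (gateOp pos (swapGate i j))ᴴ) x y =
      σ (x ∘ f) (y ∘ f) := by
    intro x y
    simp [Matrix.mul_apply, Matrix.conjTranspose_apply, gateOp_swapGate, apply_ite, hf]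
  ext s t
  rw [reduceTo_apply, reduceTo_apply, ← (Equiv.arrowCongr f (Equiv.refl (Fin 2))).sum_comp]
  refine Finset.sum_congr rfl fun x _ => ?_
  have h2 : (Equiv.arrowCongr f (Equiv.refl (Fin 2))) x = x ∘ f := by
    funext p
    simp [Equiv.arrowCongr, hf]
  rw [h1, h2]
  have h3 : (x ∘ f) (pos j) = x (pos i) := by simp [hf]
  have h4 : (x ∘ f) ∘ f = x := by
    funext p
    simp [hf]
  have h5 : Function.update (x ∘ f) (pos j) t ∘ f = Function.update x (pos i) t := by
    funext p
    by_cases hp : p = pos i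
    · subst hp; simp [hf]
    · have : f p ≠ pos j := fun h => hp (f.injective (by rw [h, hf, Equiv.swap_apply_left]))
      rw [Function.comp_apply, Function.update_of_ne this, Function.update_of_ne hp]
      exact congrFun h4 p
  rw [h3, h4, h5]

theorem trace_reduceTo (q : Fin n) (σ : QMatrix (Fin n)) : (reduceTo q σ).trace = σ.trace := by
  simp only [Matrix.trace, Matrix.diag_apply, reduceTo, Matrix.of_apply]
  rw [← (Equiv.funSplitAt q (Fin 2)).symm.sum_comp, Fintype.sum_prod_type]

theorem posSemidef_reduceTo (q : Fin n) {σ : QMatrix (Fin n)} (hσ : σ.PosSemidef) :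
    (reduceTo q σ).PosSemidef := by
  have : reduceTo q σ = ∑ z : {p : Fin n // p ≠ q} → Fin 2,
      σ.submatrix (fun s => (Equiv.funSplitAt q (Fin 2)).symm (s, z))
        (fun s => (Equiv.funSplitAt q (Fin 2)).symm (s, z)) := by
    ext s t
    simp [reduceTo, Matrix.sum_apply]
  rw [this]
  exact Matrix.posSemidef_sum _ fun z _ => hσ.submatrix _

theorem trace_insertQubit (a : Fin n) (ρ : Matrix (Fin 2) (Fin 2) ℂ)
    (τ : QMatrix {q : Fin n // q ≠ a}) : (insertQubit a ρ τ).trace = ρ.trace * τ.trace := by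
  rw [← Matrix.trace_kronecker]
  exact (Equiv.funSplitAt a (Fin 2)).sum_comp fun x => (ρ ⊗ₖ τ) x x

theorem reduceTo_insertQubit (a : Fin n) (ρ : Matrix (Fin 2) (Fin 2) ℂ)
    (τ : QMatrix {q : Fin n // q ≠ a}) : reduceTo a (insertQubit a ρ τ) = τ.trace • ρ := by
  ext s t
  simp only [reduceTo, insertQubit, Matrix.of_apply, Matrix.submatrix_apply,
    Equiv.apply_symm_apply, Matrix.kroneckerMap_apply, Matrix.smul_apply, smul_eq_mul,
    Matrix.trace, Matrix.diag_apply]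
  rw [← Finset.mul_sum, mul_comm]

/-! ### Transfer matrices -/

/-- The linear map `Y ↦ Tr_{≠ q} [V (Y ⊗ τ) V†]`. -/
def evolve (V : QMatrix (Fin n)) (a q : Fin n) (τ : QMatrix {q : Fin n // q ≠ a}) :
    Matrix (Fin 2) (Fin 2) ℂ →ₗ[ℂ] Matrix (Fin 2) (Fin 2) ℂ where
  toFun Y := reduceTo q (V * insertQubit a Y τ * Vᴴ)
  map_add' Y Y' := by
    have h : insertQubit a (Y + Y') τ = insertQubit a Y τ + insertQubit a Y' τ := by
      simp only [insertQubit, Matrix.add_kronecker]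
      rfl
    ext s t
    rw [h, Matrix.mul_add, Matrix.add_mul]
    simp [reduceTo_eq_trace, Matrix.add_mul]
  map_smul' c Y := by
    have h : insertQubit a (c • Y) τ = c • insertQubit a Y τ := by
      simp only [insertQubit, Matrix.smul_kronecker]
      rfl
    ext s t
    rw [h, Matrix.mul_smul, Matrix.smul_mul]
    simp [reduceTo_eq_trace]

theorem evolve_apply (V : QMatrix (Fin n)) (a q : Fin n) (τ : QMatrix {q : Fin n // q ≠ a})
    (Y : Matrix (Fin 2) (Fin 2) ℂ) :
    evolve V a q τ Y = reduceTo q (V * insertQubit a Y τ * Vᴴ) := rfl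

/-- The matrix of `evolve` in the basis of matrix units. -/
def transferMatrix (V : QMatrix (Fin n)) (a q : Fin n) (τ : QMatrix {q : Fin n // q ≠ a}) :
    Matrix (Fin 2 × Fin 2) (Fin 2 × Fin 2) ℂ :=
  Matrix.of fun x y => evolve V a q τ (Matrix.single y.1 y.2 1) x.1 x.2

theorem transferMatrix_mulVec (V : QMatrix (Fin n)) (a q : Fin n)
    (τ : QMatrix {q : Fin n // q ≠ a}) (Y : Matrix (Fin 2) (Fin 2) ℂ) :
    transferMatrix V a q τ *ᵥ (fun y => Y y.1 y.2) = fun x => evolve V a q τ Y x.1 x.2 := by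
  funext x
  conv_rhs => rw [Matrix.matrix_eq_sum_single Y]
  simp only [map_sum, Matrix.sum_apply, Matrix.mulVec, dotProduct, Fintype.sum_prod_type,
    transferMatrix, Matrix.of_apply]
  refine Finset.sum_congr rfl fun i _ => Finset.sum_congr rfl fun j _ => ?_
  rw [show Matrix.single i j (Y i j) = Y i j • Matrix.single i j (1 : ℂ) by
    simp [Matrix.smul_single], map_smul, Matrix.smul_apply, smul_eq_mul, mul_comm]

theorem transferMatrix_one (a : Fin n) {τ : QMatrix {q : Fin n // q ≠ a}} (hτ : IsDensity τ) :
    transferMatrix 1 a a τ = 1 := by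
  ext x y
  rw [transferMatrix, Matrix.of_apply, evolve_apply, Matrix.one_mul, Matrix.conjTranspose_one,
    Matrix.mul_one, reduceTo_insertQubit, hτ.2, one_smul, Matrix.one_apply, Matrix.single_apply]
  refine if_congr ?_ rfl rfl
  rw [Prod.ext_iff, eq_comm, eq_comm (a := y.2)]

theorem transferMatrix_gateOp_mul_of_forall_ne (pos : Fin k ↪ Fin n) (G : Gate k)
    (V : QMatrix (Fin n)) (a q : Fin n) (hq : ∀ i, pos i ≠ q) (τ : QMatrix {q : Fin n // q ≠ a}) :
    transferMatrix (gateOp pos G * V) a q τ = transferMatrix V a q τ := by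
  ext x y
  simp only [transferMatrix, Matrix.of_apply, evolve_apply]
  rw [← reduceTo_gateOp_of_forall_ne pos G q hq (V * _ * Vᴴ), Matrix.conjTranspose_mul]
  simp only [Matrix.mul_assoc]

/-- The swap is the reference gate of the moment bound: it carries the path to its next wire with no
loss of determinant. -/
theorem transferMatrix_swapGate_mul (pos : Fin k ↪ Fin n) (i j : Fin k)
    (V : QMatrix (Fin n)) (a : Fin n) (τ : QMatrix {q : Fin n // q ≠ a}) :
    transferMatrix (gateOp pos (swapGate i j) * V) a (pos j) τ =
      transferMatrix V a (pos i) τ := by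
  ext x y
  simp only [transferMatrix, Matrix.of_apply, evolve_apply]
  rw [← reduceTo_swapGate pos i j (V * _ * Vᴴ), Matrix.conjTranspose_mul]
  simp only [Matrix.mul_assoc]

/-- The diagonal entries are nonnegative with sum `c`, and a nonnegative determinant gives `|P 0 1|²
≤ P 0 0 * P 1 1`. -/
theorem norm_apply_le_of_posSemidef {P : Matrix (Fin 2) (Fin 2) ℂ} (hP : P.PosSemidef) {c : ℝ}
    (hc : P.trace = c) (i j : Fin 2) : ‖P i j‖ ≤ c := by
  have h0 := hP.diag_nonneg (i := 0)
  have h1 := hP.diag_nonneg (i := 1)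
  have hd := hP.det_nonneg
  have hs : P 1 0 = star (P 0 1) := (hP.isHermitian.apply 1 0).symm
  rw [Matrix.trace_fin_two] at hc
  rw [Matrix.det_fin_two, hs, Complex.star_def, Complex.mul_conj, Complex.normSq_eq_norm_sq] at hd
  have hreal : ∀ w : ℂ, 0 ≤ w → ∃ x : ℝ, 0 ≤ x ∧ (x : ℂ) = w := fun w hw =>
    ⟨w.re, (Complex.nonneg_iff.mp hw).1, Complex.ext rfl (Complex.nonneg_iff.mp hw).2⟩
  obtain ⟨x, hx, hx'⟩ := hreal _ h0
  obtain ⟨y, hy, hy'⟩ := hreal _ h1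
  rw [← hx', ← hy'] at hd hc
  have hc' : x + y = c := by exact_mod_cast hc
  have hd' : 0 ≤ x * y - ‖P 0 1‖ ^ 2 := by exact_mod_cast hd
  have h01 : ‖P 0 1‖ ≤ c := by nlinarith [norm_nonneg (P 0 1)]
  fin_cases i <;> fin_cases j
  · simp only [Fin.zero_eta, ← hx', Complex.norm_real, Real.norm_eq_abs, abs_of_nonneg hx]
    linarith
  · exact h01
  · simp only [Fin.mk_one, Fin.zero_eta, hs, norm_star]
    exact h01
  · simp only [Fin.mk_one, ← hy', Complex.norm_real, Real.norm_eq_abs, abs_of_nonneg hy]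
    linarith

theorem norm_evolve_le_of_posSemidef {V : QMatrix (Fin n)} (hV : Vᴴ * V = 1) (a q : Fin n)
    {τ : QMatrix {q : Fin n // q ≠ a}} (hτ : IsDensity τ) {P : Matrix (Fin 2) (Fin 2) ℂ}
    (hP : P.PosSemidef) {c : ℝ} (hc : P.trace = c) (i j : Fin 2) :
    ‖evolve V a q τ P i j‖ ≤ c := by
  refine norm_apply_le_of_posSemidef ?_ ?_ i j
  · rw [evolve_apply]
    exact posSemidef_reduceTo q
      (((hP.kronecker hτ.1).submatrix _).mul_mul_conjTranspose_same V)
  · rw [evolve_apply, trace_reduceTo, Matrix.trace_mul_comm, ← Matrix.mul_assoc, hV,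
      Matrix.one_mul, trace_insertQubit, hτ.2, mul_one, hc]

/-- Polarisation: an off-diagonal matrix unit is a combination of the positive matrices `ket 1` and
`ket I`, of trace 2, and the diagonal units, of trace 1. The bound is `(2 + 2 + 2 · 2) / 2 = 4`. -/
theorem norm_transferMatrix_le {V : QMatrix (Fin n)} (hV : Vᴴ * V = 1) (a q : Fin n)
    {τ : QMatrix {q : Fin n // q ≠ a}} (hτ : IsDensity τ) (x y : Fin 2 × Fin 2) :
    ‖transferMatrix V a q τ x y‖ ≤ 4 := by
  obtain ⟨s, t⟩ := x
  set φ := evolve V a q τ with hφ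
  obtain ⟨ket, hdef⟩ : ∃ ket : ℂ → Matrix (Fin 2) (Fin 2) ℂ,
      ∀ c, ket c = Matrix.vecMulVec ![1, c] (star ![1, c]) := ⟨_, fun _ => rfl⟩
  have p00 : ∀ c, ket c 0 0 = 1 := fun c => by simp [hdef, Matrix.vecMulVec_apply,
    -Matrix.cons_vecMulVec]
  have p01 : ∀ c, ket c 0 1 = star c := fun c => by simp [hdef, Matrix.vecMulVec_apply,
    -Matrix.cons_vecMulVec]
  have p10 : ∀ c, ket c 1 0 = c := fun c => by simp [hdef, Matrix.vecMulVec_apply,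
    -Matrix.cons_vecMulVec]
  have p11 : ∀ c, ket c 1 1 = c * star c := fun c => by
    simp [hdef, Matrix.vecMulVec_apply,
    -Matrix.cons_vecMulVec]
  have hket : ∀ c : ℂ, ‖c‖ = 1 → ‖φ (ket c) s t‖ ≤ 2 := by
    intro c hc
    refine norm_evolve_le_of_posSemidef hV a q hτ
      (hdef c ▸ Matrix.posSemidef_vecMulVec_self_star _) ?_ s t
    rw [Matrix.trace_fin_two, p00, p11, Complex.star_def, Complex.mul_conj,
      Complex.normSq_eq_norm_sq, hc]
    norm_num
  have hdiag : ∀ i : Fin 2, ‖φ (Matrix.single i i 1) s t‖ ≤ 1 := by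
    intro i
    have h : (Matrix.single i i 1 : Matrix (Fin 2) (Fin 2) ℂ) =
        Matrix.vecMulVec (Pi.single i 1) (star (Pi.single i 1)) := by
      rw [Pi.star_single, star_one, Matrix.single_eq_single_vecMulVec_single]
    refine norm_evolve_le_of_posSemidef hV a q hτ ?_ ?_ s t
    · rw [h]
      exact Matrix.posSemidef_vecMulVec_self_star _
    · simp
  have h01 : (Matrix.single 0 1 1 : Matrix (Fin 2) (Fin 2) ℂ) = (1 / 2 : ℂ) • (ket 1 +
      Complex.I • ket Complex.I -
        (1 + Complex.I) • (Matrix.single 0 0 1 + Matrix.single 1 1 1)) := by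
    ext i j
    fin_cases i <;> fin_cases j <;> simp [p00, p01, p10, p11] <;> ring
  have h10 : (Matrix.single 1 0 1 : Matrix (Fin 2) (Fin 2) ℂ) = (1 / 2 : ℂ) • (ket 1 -
      Complex.I • ket Complex.I -
        (1 - Complex.I) • (Matrix.single 0 0 1 + Matrix.single 1 1 1)) := by
    ext i j
    fin_cases i <;> fin_cases j <;> simp [p00, p01, p10, p11] <;> ring
  have hoff : ∀ (u w : ℂ), ‖u‖ ≤ 1 → ‖w‖ ≤ 2 →
      ‖(1 / 2 : ℂ) * (φ (ket 1) s t + u * φ (ket Complex.I) s t -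
        w * (φ (Matrix.single 0 0 1) s t + φ (Matrix.single 1 1 1) s t))‖ ≤ 4 := by
    intro u w hu hw
    have e1 := hket 1 (by simp)
    have e2 := hket Complex.I (by simp)
    have e3 := (norm_add_le _ _).trans (add_le_add (hdiag 0) (hdiag 1))
    have e4 := mul_le_mul hu e2 (norm_nonneg _) zero_le_one
    have e5 := mul_le_mul hw e3 (norm_nonneg _) zero_le_two
    rw [← norm_mul] at e4 e5
    have e6 := (norm_sub_le (φ (ket 1) s t + u * φ (ket Complex.I) s t)
      (w * (φ (Matrix.single 0 0 1) s t + φ (Matrix.single 1 1 1) s t)))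
    have e7 := norm_add_le (φ (ket 1) s t) (u * φ (ket Complex.I) s t)
    rw [norm_mul, show ‖(1 / 2 : ℂ)‖ = 1 / 2 by norm_num]
    linarith
  have hI : ‖(1 : ℂ) + Complex.I‖ ≤ 2 := (norm_add_le _ _).trans (by norm_num)
  have hI' : ‖(1 : ℂ) - Complex.I‖ ≤ 2 := (norm_sub_le _ _).trans (by norm_num)
  obtain ⟨i, j⟩ := y
  change ‖φ (Matrix.single i j 1) s t‖ ≤ 4
  fin_cases i <;> fin_cases j
  · exact (hdiag 0).trans (by norm_num)
  · have := hoff Complex.I (1 + Complex.I) (by simp) hI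
    simp only [Fin.zero_eta, Fin.mk_one]
    rw [h01]
    simpa only [map_smul, map_add, map_sub, Matrix.smul_apply, Matrix.add_apply,
      Matrix.sub_apply, smul_eq_mul] using this
  · have := hoff (-Complex.I) (1 - Complex.I) (by simp) hI'
    simp only [Fin.zero_eta, Fin.mk_one]
    rw [h10]
    simpa only [map_smul, map_add, map_sub, Matrix.smul_apply, Matrix.add_apply,
      Matrix.sub_apply, smul_eq_mul, neg_mul, ← sub_eq_add_neg] using this
  · exact (hdiag 1).trans (by norm_num)

/-! ### Contraction of the Frobenius norm and the determinant -/

theorem sq_frobNorm {d : Type} [Fintype d] (A : Matrix d d ℂ) :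
    frobNorm A ^ 2 = ∑ x : d × d, ‖A x.1 x.2‖ ^ 2 := by
  have h : frobNorm A = (∑ i, ∑ j, ‖A i j‖ ^ (2 : ℝ)) ^ (1 / 2 : ℝ) :=
    Matrix.frobenius_norm_def A
  rw [h, ← Real.sqrt_eq_rpow, Real.sq_sqrt, Fintype.sum_prod_type]
  · simp
  · positivity

theorem frobNorm_nonneg {d : Type} [Fintype d] (A : Matrix d d ℂ) : 0 ≤ frobNorm A := by
  have h : frobNorm A = (∑ i, ∑ j, ‖A i j‖ ^ (2 : ℝ)) ^ (1 / 2 : ℝ) :=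
    Matrix.frobenius_norm_def A
  rw [h]
  positivity

/-- An entry of the adjugate is a 4×4 determinant with entries at most 4, and `6144 = 4! · 4 ^ 4`.
-/
theorem norm_adjugate_le {M : Matrix (Fin 2 × Fin 2) (Fin 2 × Fin 2) ℂ}
    (hM : ∀ x y, ‖M x y‖ ≤ 4) (x y : Fin 2 × Fin 2) : ‖M.adjugate x y‖ ≤ 6144 := by
  rw [Matrix.adjugate_apply]
  refine (Matrix.det_le (abv := NormedField.toAbsoluteValue ℂ) (x := 4) fun i j => ?_).trans ?_
  · change ‖(M.updateRow y (Pi.single x 1)) i j‖ ≤ 4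
    rw [Matrix.updateRow_apply]
    split_ifs
    · rw [Pi.single_apply]
      split_ifs <;> norm_num
    · exact hM i j
  · simp [Nat.factorial]
    norm_num

/-- The determinant of a channel controls how much it contracts. -/
theorem det_mul_frobNorm_le {V : QMatrix (Fin n)} (hV : Vᴴ * V = 1) (a q : Fin n)
    {τ : QMatrix {q : Fin n // q ≠ a}} (hτ : IsDensity τ) (Y : Matrix (Fin 2) (Fin 2) ℂ) :
    ‖(transferMatrix V a q τ).det‖ * frobNorm Y ≤ 24576 * frobNorm (evolve V a q τ Y) := by
  set M := transferMatrix V a q τ with hM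
  have h1 : ∀ x : Fin 2 × Fin 2, M.det * Y x.1 x.2 =
      ∑ y, M.adjugate x y * evolve V a q τ Y y.1 y.2 := by
    intro x
    have h2 : M.adjugate *ᵥ (M *ᵥ fun y => Y y.1 y.2) = M.det • fun y => Y y.1 y.2 := by
      rw [Matrix.mulVec_mulVec, Matrix.adjugate_mul, Matrix.smul_mulVec, Matrix.one_mulVec]
    rw [hM, transferMatrix_mulVec, ← hM] at h2
    exact (congrFun h2 x).symm
  -- Cauchy–Schwarz over the four entries costs a factor 4; summing over `x` costs another, whence
  -- `24576 = 4 · 6144`.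
  have h3 : ∀ x : Fin 2 × Fin 2, ‖M.det * Y x.1 x.2‖ ^ 2 ≤
      4 * 6144 ^ 2 * frobNorm (evolve V a q τ Y) ^ 2 := by
    intro x
    have h4 : ‖M.det * Y x.1 x.2‖ ≤ ∑ y : Fin 2 × Fin 2, 6144 * ‖evolve V a q τ Y y.1 y.2‖ := by
      rw [h1 x]
      refine (norm_sum_le _ _).trans (Finset.sum_le_sum fun y _ => ?_)
      rw [norm_mul]
      exact mul_le_mul_of_nonneg_right
        (norm_adjugate_le (norm_transferMatrix_le hV a q hτ) x y) (norm_nonneg _)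
    refine (pow_le_pow_left₀ (norm_nonneg _) h4 2).trans (sq_sum_le_card_mul_sum_sq.trans ?_)
    rw [sq_frobNorm]
    simp only [mul_pow, ← Finset.mul_sum]
    simp
    apply le_of_eq
    ring
  rw [← abs_of_nonneg (mul_nonneg (norm_nonneg M.det) (frobNorm_nonneg Y)),
    ← abs_of_nonneg (mul_nonneg (by norm_num : (0 : ℝ) ≤ 24576)
      (frobNorm_nonneg (evolve V a q τ Y))), ← sq_le_sq, mul_pow, sq_frobNorm Y, Finset.mul_sum]
  simp only [← mul_pow, ← norm_mul]
  refine (Finset.sum_le_sum fun x _ => h3 x).trans ?_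
  simp
  apply le_of_eq
  ring

/-! ### The determinant of the transfer matrix as a function of one gate -/

theorem exists_polynomial_det (A B C : Matrix (Fin 2 × Fin 2) (Fin 2 × Fin 2) ℂ) :
    ∃ q : Polynomial ℂ, q.natDegree ≤ 8 ∧
      ∀ z : ℂ, q.eval z = (A + z • B + z ^ 2 • C).det := by
  let M : Matrix (Fin 2 × Fin 2) (Fin 2 × Fin 2) (Polynomial ℂ) := Matrix.of fun x y =>
    Polynomial.C (A x y) + Polynomial.X * Polynomial.C (B x y) +
      Polynomial.X ^ 2 * Polynomial.C (C x y)
  have hM : ∀ x y, (M x y).natDegree ≤ 2 := fun x y => by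
    simp only [M, Matrix.of_apply]
    compute_degree
  refine ⟨M.det, ?_, fun z => ?_⟩
  · rw [Matrix.det_apply]
    refine Polynomial.natDegree_sum_le_of_forall_le _ _ fun σ _ => ?_
    refine (Polynomial.natDegree_smul_le _ _).trans ((Polynomial.natDegree_prod_le _ _).trans ?_)
    refine (Finset.sum_le_sum fun x _ => hM (σ x) x).trans ?_
    simp
  · rw [← Polynomial.coe_evalRingHom, RingHom.map_det]
    congr 1
    ext x y
    simp [M, Polynomial.eval_mul]
    ring

theorem continuous_gateOp (pos : Fin k ↪ Fin n) : Continuous fun g : Gate k => gateOp pos g := by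
  refine continuous_matrix fun x y => ?_
  simp only [gateOp_eq_localOp, localOp_apply]
  split_ifs
  · exact continuous_subtype_val.matrix_elem _ _
  · exact continuous_const

theorem continuous_transferMatrix {X : Type*} [TopologicalSpace X] {V : X → QMatrix (Fin n)}
    (hV : Continuous V) (a q : Fin n) (τ : QMatrix {q : Fin n // q ≠ a}) :
    Continuous fun x => transferMatrix (V x) a q τ := by
  refine continuous_matrix fun s y => ?_
  simp only [transferMatrix, Matrix.of_apply, evolve_apply, reduceTo_eq_trace]
  exact (((hV.matrix_mul continuous_const).matrix_mul hV.matrix_conjTranspose).matrix_mul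
    continuous_const).matrix_trace

/-- The transfer matrix is sesquilinear in the gate, so along `A + z B` its entries are combinations
of `1`, `z` and `z⁻¹`. Multiplying it by `z` makes them quadratic and changes the determinant by `z
^ 4`, of modulus one; the degree is `4 · 2 = 8`. -/
theorem isCirclePolynomial_det (pos : Fin k ↪ Fin n) (V : QMatrix (Fin n)) (a q : Fin n)
    (τ : QMatrix {q : Fin n // q ≠ a}) :
    IsCirclePolynomial fun g : Gate k => (transferMatrix (gateOp pos g * V) a q τ).det := by
  refine ⟨(continuous_transferMatrix ((continuous_gateOp pos).matrix_mul continuous_const)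
    a q τ).matrix_det, fun A B => ?_⟩
  let P := localOp pos A * V
  let Q := localOp pos B * V
  let L (X Y : QMatrix (Fin n)) : Matrix (Fin 2 × Fin 2) (Fin 2 × Fin 2) ℂ :=
    Matrix.of fun x y =>
      (X * insertQubit a (Matrix.single y.1 y.2 1) τ * Yᴴ * siteOp q x.2 x.1).trace
  obtain ⟨p, hp, hpe⟩ := exists_polynomial_det (L P Q) (L P P + L Q Q) (L Q P)
  refine ⟨p, hp, fun g z hg => ?_⟩
  have hz : (z : ℂ) * star (z : ℂ) = 1 := by
    rw [Complex.star_def, Complex.mul_conj, Circle.normSq_coe, Complex.ofReal_one]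
  have hW : gateOp pos g * V = P + (z : ℂ) • Q := by
    rw [gateOp_eq_localOp, hg, localOp_add_smul, Matrix.add_mul, Matrix.smul_mul]
  have hT : (z : ℂ) • transferMatrix (gateOp pos g * V) a q τ =
      L P Q + (z : ℂ) • (L P P + L Q Q) + (z : ℂ) ^ 2 • L Q P := by
    ext x y
    simp only [transferMatrix, Matrix.of_apply, evolve_apply, reduceTo_eq_trace, hW,
      Matrix.conjTranspose_add, Matrix.conjTranspose_smul, Matrix.add_mul, Matrix.mul_add,
      Matrix.smul_mul, Matrix.mul_smul, Matrix.trace_add, Matrix.trace_smul, Matrix.smul_apply,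
      Matrix.add_apply, smul_eq_mul, L]
    linear_combination ((P * insertQubit a (Matrix.single y.1 y.2 1) τ * Qᴴ *
      siteOp q x.2 x.1).trace + z * (Q * insertQubit a (Matrix.single y.1 y.2 1) τ * Qᴴ *
      siteOp q x.2 x.1).trace) * hz
  rw [hpe, ← hT, Matrix.det_smul, norm_mul, norm_pow, Circle.norm_coe, one_pow, one_mul]

/-! ### Initial parts of a circuit -/

/-- The unitary implemented by the first `m` gates. -/
def prefixOp (A : Architecture n k) (C : Circuit A) : ℕ → QMatrix (Fin n)
  | 0 => 1
  | m + 1 => (if h : m < A.numGates then gateOp (A.pos ⟨m, h⟩) (C ⟨m, h⟩) else 1) * prefixOp A C m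

theorem prefixOp_succ (A : Architecture n k) (C : Circuit A) {m : ℕ} (h : m < A.numGates) :
    prefixOp A C (m + 1) = gateOp (A.pos ⟨m, h⟩) (C ⟨m, h⟩) * prefixOp A C m := by
  rw [prefixOp, dif_pos h]

theorem prefixOp_numGates (A : Architecture n k) (C : Circuit A) :
    prefixOp A C A.numGates = circuitOp A C := by
  have key : ∀ m ≤ A.numGates, prefixOp A C m =
      ((List.ofFn fun g => gateOp (A.pos g) (C g)).take m).reverse.prod := by
    intro m
    induction m with
    | zero => intro _; simp [prefixOp]
    | succ m ih =>
      intro hm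
      have hm' : m < A.numGates := hm
      rw [prefixOp_succ A C hm', ih hm'.le, List.take_add_one, List.reverse_append,
        List.prod_append]
      congr 1
      simp [hm']
  rw [key _ le_rfl, circuitOp, List.take_of_length_le (by simp)]

theorem prefixOp_conjTranspose_mul (A : Architecture n k) (C : Circuit A) (m : ℕ) :
    (prefixOp A C m)ᴴ * prefixOp A C m = 1 := by
  induction m with
  | zero => simp [prefixOp]
  | succ m ih =>
    by_cases h : m < A.numGates
    · rw [prefixOp_succ A C h, Matrix.conjTranspose_mul, Matrix.mul_assoc,
        ← Matrix.mul_assoc _ _ (prefixOp A C m), gateOp_conjTranspose_mul, Matrix.one_mul, ih]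
    · rw [prefixOp, dif_neg h, Matrix.one_mul, ih]

theorem prefixOp_congr (A : Architecture n k) {C C' : Circuit A} {m : ℕ}
    (h : ∀ g : Fin A.numGates, (g : ℕ) < m → C g = C' g) :
    prefixOp A C m = prefixOp A C' m := by
  induction m with
  | zero => rfl
  | succ m ih =>
    rw [prefixOp, prefixOp, ih fun g hg => h g (hg.trans (Nat.lt_succ_self m))]
    congr 1
    by_cases hm : m < A.numGates
    · rw [dif_pos hm, dif_pos hm, h ⟨m, hm⟩ (Nat.lt_succ_self m)]
    · rw [dif_neg hm, dif_neg hm]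

theorem continuous_prefixOp (A : Architecture n k) (m : ℕ) :
    Continuous fun C : Circuit A => prefixOp A C m := by
  induction m with
  | zero => exact continuous_const
  | succ m ih =>
    by_cases h : m < A.numGates
    · simp only [prefixOp_succ A _ h]
      exact ((continuous_gateOp _).comp (continuous_apply (⟨m, h⟩ : Fin A.numGates))).matrix_mul ih
    · simp only [prefixOp, dif_neg h, Matrix.one_mul]
      exact ih

/-! ### Propagation along a path -/

/-- Starting on wire `a` before the first gate, and jumping `L` times between wires that a common
gate acts on, a path is on wire `q` after `m` gates. -/
inductive Architecture.Reach (A : Architecture n k) (a : Fin n) : ℕ → Fin n → ℕ → Prop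
  | init : A.Reach a 0 a 0
  | idle {m : ℕ} {q : Fin n} {L : ℕ} (h : m < A.numGates) (hq : ¬A.ActsOn ⟨m, h⟩ q) :
      A.Reach a m q L → A.Reach a (m + 1) q L
  | gate {m : ℕ} {q q' : Fin n} {L : ℕ} (h : m < A.numGates) (hq : A.ActsOn ⟨m, h⟩ q)
      (hq' : A.ActsOn ⟨m, h⟩ q') : A.Reach a m q L → A.Reach a (m + 1) q' (L + 1)

/-- The number of gates among the first `m` ones that act on wire `q`. -/
def Architecture.countBefore (A : Architecture n k) (m : ℕ) (q : Fin n) : ℕ :=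
  Set.ncard {h : Fin A.numGates | (h : ℕ) < m ∧ A.ActsOn h q}

theorem Architecture.countBefore_mono (A : Architecture n k) (q : Fin n) :
    Monotone fun m => A.countBefore m q := fun _ _ h =>
  Set.ncard_le_ncard (fun _ hg => ⟨hg.1.trans_le h, hg.2⟩) (Set.toFinite _)

theorem Architecture.countBefore_succ_of_actsOn (A : Architecture n k) {m : ℕ} {q : Fin n}
    (h : m < A.numGates) (hq : A.ActsOn ⟨m, h⟩ q) :
    A.countBefore (m + 1) q = A.countBefore m q + 1 := by
  have hs : {g : Fin A.numGates | (g : ℕ) < m + 1 ∧ A.ActsOn g q} =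
      insert ⟨m, h⟩ {g : Fin A.numGates | (g : ℕ) < m ∧ A.ActsOn g q} := by
    ext g
    simp only [Set.mem_ofPred_eq, Set.mem_insert_iff, Nat.lt_succ_iff_lt_or_eq]
    constructor
    · rintro ⟨h1 | h1, h2⟩
      · exact Or.inr ⟨h1, h2⟩
      · exact Or.inl (Fin.ext h1)
    · rintro (rfl | ⟨h1, h2⟩)
      · exact ⟨Or.inr rfl, hq⟩
      · exact ⟨Or.inl h1, h2⟩
  rw [Architecture.countBefore, hs, Set.ncard_insert_of_notMem (by simp) (Set.toFinite _)]
  rfl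

theorem Architecture.Reach.extend {A : Architecture n k} {a q : Fin n} {m₀ L : ℕ}
    (h : A.Reach a m₀ q L) {m : ℕ} (hm : m₀ ≤ m) (hmN : m ≤ A.numGates)
    (hc : A.countBefore m q = A.countBefore m₀ q) : A.Reach a m q L := by
  induction m, hm using Nat.le_induction with
  | base => exact h
  | succ m hm ih =>
    have h1 := A.countBefore_mono q hm
    have h2 := A.countBefore_mono q (Nat.le_succ m)
    simp only [Nat.succ_eq_add_one] at h1 h2
    have hmN' : m < A.numGates := hmN
    refine Reach.idle hmN' (fun hq => ?_) (ih hmN'.le (by omega))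
    have := A.countBefore_succ_of_actsOn hmN' hq
    omega

theorem Architecture.HasPath.reach {A : Architecture n k} {a b : Fin n} {L : ℕ}
    (h : A.HasPath (inputQubit a) (A.outputQubit b) L) : A.Reach a A.numGates b L := by
  obtain ⟨p, h0, hL, hp⟩ := h
  -- All times `m` at which the segment is current are covered, since the next gate of the path may
  -- come much later.
  have key : ∀ i ≤ L, ∀ m ≤ A.numGates, A.countBefore m (p i).wire = (p i).segment →
      A.Reach a m (p i).wire i := by
    intro i
    induction i with
    | zero =>
      intro _ m hm hc
      rw [h0] at hc ⊢
      refine Reach.init.extend (Nat.zero_le m) hm (hc.trans ?_)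
      simp [Architecture.countBefore, inputQubit]
    | succ i ih =>
      intro hi m hm hc
      obtain ⟨g, ⟨hg1, hg2⟩, hg3, hg4⟩ := hp i hi
      have hr := Reach.gate g.2 hg1 hg3 (ih (Nat.le_of_lt hi) g g.2.le hg2.symm)
      have hc' : A.countBefore (g + 1) (p (i + 1)).wire = (p (i + 1)).segment := by
        rw [A.countBefore_succ_of_actsOn g.2 hg3, hg4]
        rfl
      -- Time `m` comes after `g`: up to `g`, the gate count on this wire is still below the
      -- segment.
      refine hr.extend ?_ hm (hc.trans hc'.symm)
      by_contra hlt
      have h1 := A.countBefore_mono (p (i + 1)).wire (show m ≤ (g : ℕ) by omega)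
      have h2 := A.countBefore_succ_of_actsOn g.2 hg3
      simp only at h1
      omega
  have := key L le_rfl A.numGates le_rfl (by
    rw [hL]
    simp [Architecture.countBefore, Architecture.outputQubit])
  rwa [hL] at this

/-- Without jumps the walk stays on wire `a`, and no gate so far has acted on it. This serves depth
0, where no power of `2 ^ (-D)` can absorb the constant 24576. -/
theorem Architecture.Reach.transferMatrix_eq_one {A : Architecture n k} {a q : Fin n} {m L : ℕ}
    (h : A.Reach a m q L) (hL : L = 0) {τ : QMatrix {q : Fin n // q ≠ a}} (hτ : IsDensity τ)
    (C : Circuit A) : transferMatrix (prefixOp A C m) a q τ = 1 := by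
  induction h with
  | init => exact transferMatrix_one a hτ
  | idle h hq _ ih =>
    rw [prefixOp_succ A C h, transferMatrix_gateOp_mul_of_forall_ne _ _ _ _ _
      (fun i hi => hq ⟨i, hi⟩), ih hL]
  | gate => exact absurd hL (Nat.succ_ne_zero _)

/-! ### Averaging over the random circuit -/

instance instIsMulLeftInvariantHaarGate (k : ℕ) : (haarGate k).IsMulLeftInvariant := by
  unfold haarGate
  infer_instance

instance instIsProbabilityMeasureRandomCircuit (A : Architecture n k) :
    IsProbabilityMeasure (randomCircuit A) := by
  unfold randomCircuit
  infer_instance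

instance instIsMulLeftInvariantRandomCircuit (A : Architecture n k) :
    (randomCircuit A).IsMulLeftInvariant := by
  unfold randomCircuit
  infer_instance

theorem lintegral_randomCircuit_mul_left (A : Architecture n k) (F : Circuit A → ENNReal)
    (C₀ : Circuit A) :
    ∫⁻ C, F (C₀ * C) ∂randomCircuit A = ∫⁻ C, F C ∂randomCircuit A :=
  lintegral_mul_left_eq_self F C₀

theorem continuous_mulSingle_circuit (A : Architecture n k) (g : Fin A.numGates) :
    Continuous fun v : Gate k => (Pi.mulSingle g v : Circuit A) := by
  refine continuous_pi fun j => ?_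
  by_cases h : j = g
  · subst h
    simp only [Pi.mulSingle_eq_same]
    exact continuous_id
  · simp only [Pi.mulSingle_eq_of_ne h]
    exact continuous_const

/-- The mean over a random circuit may be computed by first averaging over a random modification
of one gate. -/
theorem lintegral_randomCircuit_le (A : Architecture n k) (g : Fin A.numGates)
    {F G : Circuit A → ENNReal} (hF : Measurable F) (μ : Measure (Gate k)) [IsProbabilityMeasure μ]
    (h : ∀ C, ∫⁻ v, F (Pi.mulSingle g v * C) ∂μ ≤ G C) :
    ∫⁻ C, F C ∂randomCircuit A ≤ ∫⁻ C, G C ∂randomCircuit A := by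
  have hmeas : Measurable fun x : Gate k × Circuit A => F (Pi.mulSingle g x.1 * x.2) :=
    hF.comp (((continuous_mulSingle_circuit A g).comp continuous_fst).mul
      continuous_snd).measurable
  calc ∫⁻ C, F C ∂randomCircuit A
      = ∫⁻ _ : Gate k, ∫⁻ C, F C ∂randomCircuit A ∂μ := by
        rw [lintegral_const, measure_univ, mul_one]
    _ = ∫⁻ v, ∫⁻ C, F (Pi.mulSingle g v * C) ∂randomCircuit A ∂μ :=
        lintegral_congr fun v => (lintegral_randomCircuit_mul_left A F _).symm
    _ = ∫⁻ C, ∫⁻ v, F (Pi.mulSingle g v * C) ∂μ ∂randomCircuit A :=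
        lintegral_lintegral_swap hmeas.aemeasurable
    _ ≤ _ := lintegral_mono h

theorem continuous_det_transferMatrix (A : Architecture n k) (a q : Fin n) (m : ℕ)
    (τ : QMatrix {q : Fin n // q ≠ a}) :
    Continuous fun C : Circuit A => (transferMatrix (prefixOp A C m) a q τ).det :=
  (continuous_transferMatrix (continuous_prefixOp A m) a q τ).matrix_det

/-- A Haar random gate decreases the determinant by at most a constant factor, in the sense of
negative moments. -/
theorem lintegral_det_gate_le (k : ℕ) : ∃ K : ENNReal, K ≠ ⊤ ∧
    ∀ (n : ℕ) (A : Architecture n k) (a q q' : Fin n) (τ : QMatrix {q : Fin n // q ≠ a}) (m : ℕ)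
      (hm : m < A.numGates), A.ActsOn ⟨m, hm⟩ q → A.ActsOn ⟨m, hm⟩ q' →
      ∫⁻ C, ‖(transferMatrix (prefixOp A C (m + 1)) a q' τ).det‖ₑ ^ (-(1 / 16) : ℝ)
          ∂randomCircuit A ≤
        K * ∫⁻ C, ‖(transferMatrix (prefixOp A C m) a q τ).det‖ₑ ^ (-(1 / 16) : ℝ)
          ∂randomCircuit A := by
  obtain ⟨μ, hμ, K, hK, hbound⟩ := controlsMoments_univ (k := k)
  refine ⟨K, hK, ?_⟩
  rintro n A a _ _ τ m hm ⟨i, rfl⟩ ⟨j, rfl⟩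
  set g : Fin A.numGates := ⟨m, hm⟩ with hg
  have hshift : ∀ (v : Gate k) (C : Circuit A), prefixOp A (Pi.mulSingle g v * C) (m + 1) =
      gateOp (A.pos g) (v * C g) * prefixOp A C m := by
    intro v C
    rw [prefixOp_succ A _ hm, ← hg, Pi.mul_apply, Pi.mulSingle_eq_same]
    congr 1
    refine prefixOp_congr A fun g' hg' => ?_
    have : g' ≠ g := fun h => by
      rw [h] at hg'
      exact lt_irrefl _ hg'
    rw [Pi.mul_apply, Pi.mulSingle_eq_of_ne this, one_mul]
  rw [← lintegral_const_mul' _ _ hK]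
  refine lintegral_randomCircuit_le A g ((continuous_det_transferMatrix A a _
    (m + 1) τ).measurable.enorm.pow_const _) μ fun C => ?_
  -- The comparison point cancels the actual gate `C g` and puts the swap of the two wires in its
  -- place.
  have h := hbound _ ((isCirclePolynomial_det (A.pos g) (prefixOp A C m) a (A.pos g j)
    τ).mul_right (C g)) (swapGate i j * (C g)⁻¹) (Set.mem_univ _)
  rw [inv_mul_cancel_right, transferMatrix_swapGate_mul] at h
  simpa only [hshift] using h

/-- Only jumps cost a factor, so the exponent is the path length and not the number of gates. -/
theorem lintegral_det_le (k : ℕ) : ∃ K : ENNReal, K ≠ ⊤ ∧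
    ∀ (n : ℕ) (A : Architecture n k) (a q : Fin n) (τ : QMatrix {q : Fin n // q ≠ a}) (m L : ℕ),
      IsDensity τ → A.Reach a m q L →
      ∫⁻ C, ‖(transferMatrix (prefixOp A C m) a q τ).det‖ₑ ^ (-(1 / 16) : ℝ)
          ∂randomCircuit A ≤ K ^ L := by
  obtain ⟨K, hK, h⟩ := lintegral_det_gate_le k
  refine ⟨K, hK, fun n A a q τ m L hτ hr => ?_⟩
  induction hr with
  | init =>
    simp only [prefixOp, transferMatrix_one a hτ]
    simp
  | idle hm hq _ ih =>
    refine le_trans (le_of_eq ?_) ih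
    refine lintegral_congr fun C => ?_
    rw [prefixOp_succ A C hm, transferMatrix_gateOp_mul_of_forall_ne _ _ _ _ _
      (fun i hi => hq ⟨i, hi⟩)]
  | gate hm hq hq' _ ih =>
    rw [pow_succ']
    exact (h n A a _ _ τ _ hm hq hq').trans (mul_le_mul_right ih K)

/-! ### From moments to probabilities -/

theorem channel_sub (A : Architecture n k) (C : Circuit A) (a b : Fin n)
    (τ : QMatrix {q : Fin n // q ≠ a}) (ρ ρ' : Matrix (Fin 2) (Fin 2) ℂ) :
    channel A C a b τ ρ - channel A C a b τ ρ' =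
      evolve (prefixOp A C A.numGates) a b τ (ρ - ρ') := by
  rw [map_sub, prefixOp_numGates]
  rfl

theorem pow_le_of_rpow_neg_enorm_le {w : ℂ} {x : ℝ} (hx : 0 < x)
    (h : ‖w‖ₑ ^ (-(1 / 16) : ℝ) ≤ ENNReal.ofReal x) : x⁻¹ ^ 16 ≤ ‖w‖ := by
  have h1 := ennreal_rpow_neg_le h (s := 16) (by norm_num)
  rw [← ENNReal.rpow_mul, show (-(1 / 16) * -16 : ℝ) = 1 by norm_num, ENNReal.rpow_one,
    ENNReal.ofReal_rpow_of_pos hx, ← ofReal_norm, ENNReal.ofReal_le_ofReal_iff (norm_nonneg _)] at h1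
  rwa [inv_pow, ← Real.rpow_natCast, ← Real.rpow_neg hx.le]

/-- As `D ≥ 1`, the factor `2 ^ (-31 D)` absorbs 24576, while `2 ^ (-16 l D)` pays for `K ^ (16 D)`.
The surplus power of `γ ≤ 1` is dropped. -/
theorem two_rpow_neg_mul_pow_le {D l : ℕ} (hD : D ≠ 0) {γ K : ℝ} (hγ : 0 < γ) (hγ' : γ ≤ 1)
    (hK : 0 < K) (hl : K ≤ 2 ^ l) :
    24576 * ((2 : ℝ) ^ (-(D : ℝ)) * γ) ^ (31 + 16 * l) ≤ (K ^ D / γ)⁻¹ ^ 16 := by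
  have h1 : γ ^ (31 + 16 * l) ≤ γ ^ 16 := pow_le_pow_of_le_one hγ.le hγ' (by omega)
  have h2 : (24576 : ℝ) ≤ 2 ^ (31 * D) :=
    le_trans (by norm_num : (24576 : ℝ) ≤ 2 ^ 31)
      (pow_le_pow_right₀ one_le_two (by omega))
  have h3 : (K ^ D) ^ 16 ≤ ((2 : ℝ) ^ l) ^ (16 * D) := by
    rw [← pow_mul, mul_comm D 16]
    exact pow_le_pow_left₀ hK.le hl _
  rw [Real.rpow_neg zero_le_two, Real.rpow_natCast, inv_div, div_pow, mul_pow, inv_pow,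
    le_div_iff₀ (by positivity)]
  have h4 : ((2 : ℝ) ^ D) ^ (31 + 16 * l) = 2 ^ (31 * D) * (2 ^ l) ^ (16 * D) := by
    rw [← pow_mul, ← pow_mul, ← pow_add]
    congr 1
    ring
  rw [h4]
  calc 24576 * ((2 ^ (31 * D) * (2 ^ l) ^ (16 * D))⁻¹ * γ ^ (31 + 16 * l)) * (K ^ D) ^ 16
      ≤ 2 ^ (31 * D) * ((2 ^ (31 * D) * (2 ^ l) ^ (16 * D))⁻¹ * γ ^ 16) *
          ((2 : ℝ) ^ l) ^ (16 * D) := by gcongr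
    _ = γ ^ 16 := by field_simp

end RandomCircuit

end

theorem mainTheorem3 (k : ℕ) :
    ∃ c : ℝ, 0 < c ∧
      ∀ (n : ℕ) (A : RandomCircuit.Architecture n k) (a b : Fin n) (D : ℕ),
        A.DepthApart (RandomCircuit.inputQubit a) (A.outputQubit b) D →
        ∀ τ : RandomCircuit.QMatrix {q : Fin n // q ≠ a}, RandomCircuit.IsDensity τ →
        ∀ γ : ℝ, 0 < γ →
          ENNReal.ofReal (1 - γ) ≤
            RandomCircuit.randomCircuit A
              {C | ∀ ρ ρ' : Matrix (Fin 2) (Fin 2) ℂ,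
                RandomCircuit.IsDensity ρ → RandomCircuit.IsDensity ρ' →
                RandomCircuit.frobNorm (ρ - ρ') * ((2 : ℝ) ^ (-(D : ℝ)) * γ) ^ c ≤
                  RandomCircuit.frobNorm
                    (RandomCircuit.channel A C a b τ ρ - RandomCircuit.channel A C a b τ ρ')} := by
  open RandomCircuit MeasureTheory in
  obtain ⟨K, hK, hmoment⟩ := lintegral_det_le k
  obtain ⟨l, hl⟩ := pow_unbounded_of_one_lt (max 1 K.toReal) one_lt_two
  refine ⟨(31 + 16 * l : ℕ), by positivity, fun n A a b D hD τ hτ γ hγ => ?_⟩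
  rcases le_or_gt 1 γ with hγ1 | hγ1
  · rw [ENNReal.ofReal_of_nonpos (by linarith)]
    exact zero_le
  have hr := hD.1.reach
  simp only [Real.rpow_natCast, channel_sub]
  rcases Nat.eq_zero_or_pos D with rfl | hDpos
  · have hall : ∀ C : Circuit A, ∀ Y : Matrix (Fin 2) (Fin 2) ℂ,
        evolve (prefixOp A C A.numGates) a b τ Y = Y := by
      intro C Y
      have h := transferMatrix_mulVec (prefixOp A C A.numGates) a b τ Y
      rw [hr.transferMatrix_eq_one rfl hτ C, Matrix.one_mulVec] at h
      ext i j
      exact (congrFun h (i, j)).symm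
    refine le_trans ?_ (le_of_eq ((measure_univ (μ := randomCircuit A)).symm.trans
      (congrArg _ (Set.eq_univ_of_forall ?_).symm)))
    · exact ENNReal.ofReal_le_one.mpr (by linarith)
    · intro C ρ ρ' _ _
      rw [hall]
      refine mul_le_of_le_one_right (frobNorm_nonneg _) (pow_le_one₀ (by positivity) ?_)
      simpa using hγ1.le
  · set κ := max 1 K.toReal with hκ
    have hκpos : 0 < κ := zero_lt_one.trans_le (le_max_left _ _)
    have hKκ : K ≤ ENNReal.ofReal κ := by
      rw [← ENNReal.ofReal_toReal hK]
      exact ENNReal.ofReal_le_ofReal (le_max_right _ _)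
    have hx : 0 < κ ^ D / γ := by positivity
    -- `F` is `⊤` where the determinant vanishes, so singular channels fall into the exceptional
    -- event.
    let F : Circuit A → ENNReal := fun C =>
      ‖(transferMatrix (prefixOp A C A.numGates) a b τ).det‖ₑ ^ (-(1 / 16) : ℝ)
    have hF : Measurable F :=
      (continuous_det_transferMatrix A a b A.numGates τ).measurable.enorm.pow_const _
    have hmarkov : randomCircuit A {C | ENNReal.ofReal (κ ^ D / γ) ≤ F C} ≤ ENNReal.ofReal γ := by
      refine (meas_ge_le_lintegral_div hF.aemeasurable (by simpa using hx)
        ENNReal.ofReal_ne_top).trans (ENNReal.div_le_of_le_mul ?_)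
      rw [← ENNReal.ofReal_mul hγ.le, mul_div_cancel₀ _ hγ.ne', ENNReal.ofReal_pow hκpos.le]
      exact (hmoment n A a b τ _ D hτ hr).trans (pow_le_pow_left' hKκ D)
    -- The good event concerns the determinant alone, hence serves all pairs of states
    -- simultaneously.
    have hsub : {C | ENNReal.ofReal (κ ^ D / γ) ≤ F C}ᶜ ⊆
        {C : Circuit A | ∀ ρ ρ' : Matrix (Fin 2) (Fin 2) ℂ, IsDensity ρ → IsDensity ρ' →
          frobNorm (ρ - ρ') * ((2 : ℝ) ^ (-(D : ℝ)) * γ) ^ (31 + 16 * l) ≤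
            frobNorm (evolve (prefixOp A C A.numGates) a b τ (ρ - ρ'))} := by
      intro C hC ρ ρ' _ _
      have h1 := pow_le_of_rpow_neg_enorm_le hx
        (not_le.mp (show ¬ENNReal.ofReal (κ ^ D / γ) ≤ F C from hC)).le
      have h2 := det_mul_frobNorm_le (prefixOp_conjTranspose_mul A C A.numGates) a b hτ (ρ - ρ')
      have h3 := (two_rpow_neg_mul_pow_le hDpos.ne' hγ hγ1.le hκpos hl.le).trans h1
      have h4 := (mul_le_mul_of_nonneg_right h3 (frobNorm_nonneg (ρ - ρ'))).trans h2
      linarith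
    refine le_trans ?_ (measure_mono hsub)
    rw [prob_compl_eq_one_sub (measurableSet_le measurable_const hF),
      ENNReal.ofReal_sub _ hγ.le, ENNReal.ofReal_one]
    exact tsub_le_tsub_left hmarkov 1
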